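/- For $a,b\in\mathbb{Q}^\times$ let $H_{a,b}=\mathbb{Q}\cdot 1\oplus\mathbb{Q}\cdot\alpha\oplus\mathbb{Q}\cdot\beta\oplus\mathbb{Q}\cdot\alpha\beta$ be the quaternion algebra over $\mathbb{Q}$ with $\alpha^2=a$, $\beta^2=b$, $\alpha\beta=-\beta\alpha$. Let $\mathbb{P}$ be the set of rational primes, put $\mathbb{Q}_\infty:=\mathbb{R}$, and let $$\Delta_{a,b}:=\{p\in\mathbb{P}\cup\{\infty\} : H_{a,b}\otimes_{\mathbb{Q}}\mathbb{Q}_p\not\cong M_2(\mathbb{Q}_p)\text{ as }\mathbb{Q}_p\text{-algebras}\}$$ be the set of places where $H_{a,b}$ does not split. Let $$S_{a,b}:=\{2x_1 : x_1\in\mathbb{Q},\ \exists\, x_2,x_3,x_4\in\mathbb{Q}:\ x_1^2-ax_2^2-bx_3^2+abx_4^2=1\}$$ be the set of traces of norm-$1$ elements of $H_{a,b}$, and let $T_{a,b}:=S_{a,b}+S_{a,b}=\{s+s' : s,s'\in S_{a,b}\}$. For $p\in\mathbb{P}$ let $\mathbb{Z}_{(p)}\subseteq\mathbb{Q}$ be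 the set of rationals whose denominator in lowest terms is not divisible by $p$, and let $\mathbb{Z}_{(\infty)}:=\{x\in\mathbb{Q} : -4\le x\le 4\}$. **Proposition.** For all $a,b\in\mathbb{Q}^\times$, $$T_{a,b}=\bigcap_{p\in\Delta_{a,b}}\mathbb{Z}_{(p)},$$ where the empty intersection is understood to be $\mathbb{Q}$; that is, $T_{a,b}=\mathbb{Q}$ if $\Delta_{a,b}=\emptyset$. -/

import Mathlib

open scoped TensorProduct Quaternion Pointwise

/-- The places of `ℚ`, i.e. `ℙ ∪ {∞}`. -/
inductive RatPlace : Type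
  | infinite : RatPlace
  | finite (p : Nat.Primes) : RatPlace

/-- The rational quaternion algebra `H_{a,b} = ℚ·1 ⊕ ℚ·α ⊕ ℚ·β ⊕ ℚ·αβ` with
`α² = a`, `β² = b`, `αβ = -βα`. -/
abbrev RatQuaternion (a b : ℚ) : Type := ℍ[ℚ, a, b]

/-- `H_{a,b}` splits over the field `K ⊇ ℚ`: the base change of `H_{a,b}` to `K` is isomorphic,
as a `K`-algebra, to the algebra of `2 × 2` matrices over `K`. -/
def SplitsOver (a b : ℚ) (K : Type) [Field K] [Algebra ℚ K] : Prop :=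
  Nonempty ((K ⊗[ℚ] RatQuaternion a b) ≃ₐ[K] Matrix (Fin 2) (Fin 2) K)

/-- `H_{a,b}` splits at a place of `ℚ`, i.e. over the corresponding completion `ℝ` or `ℚ_p`. -/
def SplitsAt (a b : ℚ) : RatPlace → Prop
  | .infinite => SplitsOver a b ℝ
  | .finite p => haveI : Fact (p : ℕ).Prime := ⟨p.2⟩; SplitsOver a b ℚ_[(p : ℕ)]

/-- The set `Δ_{a,b}` of places of `ℚ` at which `H_{a,b}` does not split. -/
def ramifiedPlaces (a b : ℚ) : Set RatPlace := {v | ¬ SplitsAt a b v}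

/-- The set `S_{a,b}` of traces of norm-`1` elements of `H_{a,b}`. -/
def traceSet (a b : ℚ) : Set ℚ :=
  {t | ∃ x₁ x₂ x₃ x₄ : ℚ,
    x₁ ^ 2 - a * x₂ ^ 2 - b * x₃ ^ 2 + a * b * x₄ ^ 2 = 1 ∧ t = 2 * x₁}

/-- `S_{a,b}` is the set of `q + q̄` for `q ∈ H_{a,b}` with `q q̄ = 1`. -/
theorem mem_traceSet_iff (a b t : ℚ) :
    t ∈ traceSet a b ↔ ∃ q : RatQuaternion a b,
      q * star q = 1 ∧ q + star q = algebraMap ℚ (RatQuaternion a b) t := by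
  constructor
  · rintro ⟨x₁, x₂, x₃, x₄, h, rfl⟩
    refine ⟨⟨x₁, x₂, x₃, x₄⟩, ?_, ?_⟩
    · ext <;> simp <;> linarith
    · ext <;> simp [QuaternionAlgebra.algebraMap_eq]
      ring
  · rintro ⟨q, h, ht⟩
    have h1 := congrArg QuaternionAlgebra.re h
    have h2 := congrArg QuaternionAlgebra.re ht
    simp [QuaternionAlgebra.algebraMap_eq] at h1 h2
    exact ⟨q.re, q.imI, q.imJ, q.imK, by linarith, by linarith⟩

/-- `T_{a,b} = S_{a,b} + S_{a,b}`, the set of all sums of two elements of `S_{a,b}`. -/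
def traceSumSet (a b : ℚ) : Set ℚ := traceSet a b + traceSet a b

/-- `ℤ_(p)`, the localization of `ℤ` at `p`, inside `ℚ`: the rationals whose reduced denominator
is not divisible by `p`. For the infinite place this is `ℤ_(∞) = [-4, 4] ∩ ℚ`. -/
def localIntegers : RatPlace → Set ℚ
  | .infinite => {x | -4 ≤ x ∧ x ≤ 4}
  | .finite p => {x | ¬ (p : ℕ) ∣ x.den}

/-!
A rational number `s` is the trace of a norm-one quaternion if and only if `s ^ 2 - 4` is the square
of a pure quaternion, that is, a value of the ternary form `⟨a, b, -ab⟩`. If `s` is large at a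
place, then `s ^ 2 - 4` is a nonzero square there, which makes the norm form isotropic and the
algebra split: this bounds the traces at the ramified places.

Conversely, `⟨a, b, -ab⟩` represents a nonzero `c` as soon as `c` is not a square at any ramified
place. Indeed `c` is represented once some `n` makes the algebras `(a, -nb)` and `(ac, na)` split.
A prime in an arithmetic progression, prescribed by the local solutions, gives such an `n` up to one
further place, which the product formula for Hilbert symbols takes care of; Legendre's descent then
turns trivial symbols into a global splitting. A number that is locally integral at the ramified
places is therefore a sum of two traces if at each of them it is a sum of two local traces with
nonsquare discriminants. At an odd prime this is a counting argument in the residue field: over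
half of the residues lift to such traces, so every residue is a sum of two of them.
-/

/-- `b` is a norm from `K(√a)`, that is, it is represented by the form `⟨1, -a⟩`. For nonzero `a`
and `b` over a field of characteristic not two this says that the quaternion algebra `(a, b)` over
`K` splits, a condition which is symmetric in `a` and `b`. -/
def IsNormFrom {K : Type*} [Field K] (a b : K) : Prop := ∃ x y : K, x ^ 2 - a * y ^ 2 = b

namespace IsNormFrom

variable {K : Type*} [Field K] {a b c r : K}

theorem mul (hb : IsNormFrom a b) (hc : IsNormFrom a c) : IsNormFrom a (b * c) := by
  obtain ⟨x, y, rfl⟩ := hb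
  obtain ⟨z, w, rfl⟩ := hc
  exact ⟨x * z + a * y * w, x * w + y * z, by ring⟩

theorem map {L : Type*} [Field L] (f : K →+* L) (h : IsNormFrom a b) :
    IsNormFrom (f a) (f b) := by
  obtain ⟨x, y, rfl⟩ := h
  exact ⟨f x, f y, by simp⟩

theorem sq (a r : K) : IsNormFrom a (r ^ 2) := ⟨r, 0, by ring⟩

theorem one_right (a : K) : IsNormFrom a 1 := ⟨1, 0, by ring⟩

theorem neg_self (a : K) : IsNormFrom a (-a) := ⟨0, 1, by ring⟩

theorem mul_sq_right_iff (hr : r ≠ 0) : IsNormFrom a (b * r ^ 2) ↔ IsNormFrom a b := by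
  refine ⟨?_, fun h => h.mul (sq a r)⟩
  rintro ⟨x, y, h⟩
  refine ⟨x / r, y / r, ?_⟩
  field_simp
  linear_combination h

theorem mul_sq_left_iff (hr : r ≠ 0) : IsNormFrom (a * r ^ 2) b ↔ IsNormFrom a b := by
  constructor
  · rintro ⟨x, y, h⟩
    exact ⟨x, r * y, by linear_combination h⟩
  · rintro ⟨x, y, h⟩
    refine ⟨x, y / r, ?_⟩
    field_simp
    linear_combination h

theorem mul_right_iff (hb₀ : b ≠ 0) (hb : IsNormFrom a b) :
    IsNormFrom a (b * c) ↔ IsNormFrom a c := by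
  refine ⟨fun h => (mul_sq_right_iff hb₀).1 ?_, hb.mul⟩
  rw [show c * b ^ 2 = b * (b * c) by ring]
  exact hb.mul h

theorem neg_mul_self_right_iff (ha : a ≠ 0) : IsNormFrom a (-(a * b)) ↔ IsNormFrom a b := by
  rw [← neg_mul]
  exact (neg_self a).mul_right_iff (neg_ne_zero.2 ha)

theorem isSquare_of_isotropic {x y : K} (h : x ^ 2 - a * y ^ 2 = 0) (hxy : x ≠ 0 ∨ y ≠ 0) :
    IsSquare a := by
  have hy : y ≠ 0 := by
    rintro rfl
    simp_all
  refine ⟨x / y, ?_⟩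
  field_simp
  linear_combination -h

variable [NeZero (2 : K)]

theorem of_isSquare (ha : a ≠ 0) (h : IsSquare a) (b : K) : IsNormFrom a b := by
  obtain ⟨r, rfl⟩ := h
  have hr : r ≠ 0 := left_ne_zero_of_mul ha
  have h2 : (2 : K) ≠ 0 := NeZero.ne 2
  refine ⟨(b + 1) / 2, (b - 1) / (2 * r), ?_⟩
  field_simp
  ring

theorem symm (hb : b ≠ 0) (h : IsNormFrom a b) : IsNormFrom b a := by
  obtain ⟨x, y, h⟩ := h
  by_cases hy : y = 0
  · subst hy
    exact of_isSquare hb ⟨x, by linear_combination -h⟩ a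
  · refine ⟨x / y, 1 / y, ?_⟩
    field_simp
    linear_combination h

theorem comm (ha : a ≠ 0) (hb : b ≠ 0) : IsNormFrom a b ↔ IsNormFrom b a := ⟨symm hb, symm ha⟩

theorem of_isotropic_normForm (ha : a ≠ 0) {x y z w : K}
    (h : x ^ 2 - a * y ^ 2 - b * z ^ 2 + a * b * w ^ 2 = 0)
    (hne : x ≠ 0 ∨ y ≠ 0 ∨ z ≠ 0 ∨ w ≠ 0) : IsNormFrom a b := by
  by_cases h0 : z ^ 2 - a * w ^ 2 = 0
  · by_cases hzw : z ≠ 0 ∨ w ≠ 0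
    · exact of_isSquare ha (isSquare_of_isotropic h0 hzw) b
    · obtain ⟨rfl, rfl⟩ : z = 0 ∧ w = 0 := by simpa only [not_or, not_not] using hzw
      exact of_isSquare ha
        (isSquare_of_isotropic (x := x) (y := y) (by linear_combination h) (by simpa using hne)) b
  · have hzw : IsNormFrom a (z ^ 2 - a * w ^ 2) := ⟨z, w, rfl⟩
    exact (hzw.mul_right_iff h0).1 ⟨x, y, by linear_combination h⟩

theorem exists_pure_sq_eq (ha : a ≠ 0) (hb : b ≠ 0) (h : IsNormFrom a b) (c : K) :
    ∃ x y z : K, a * x ^ 2 + b * y ^ 2 - a * b * z ^ 2 = c := by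
  obtain ⟨u, v, rfl⟩ := h
  have h2 : (2 : K) ≠ 0 := NeZero.ne 2
  -- `⟨a, b, -ab⟩` contains the hyperbolic plane `⟨a, -a⟩`, which represents everything.
  obtain ⟨X, Z, hXZ⟩ : ∃ X Z : K, a * (X ^ 2 - Z ^ 2) = c :=
    ⟨(c / a + 1) / 2, (c / a - 1) / 2, by field_simp; ring⟩
  refine ⟨X, -(a * v * Z) / (u ^ 2 - a * v ^ 2), u * Z / (u ^ 2 - a * v ^ 2), ?_⟩
  rw [← hXZ]
  field_simp
  ring

/-- A common value `-n` of `-⟨b, -ab⟩` and `⟨a, -c⟩` turns into a representation of `c` by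
`⟨a, b, -ab⟩`. -/
theorem exists_pure_sq_eq_of_common_slot (ha : a ≠ 0) (hb : b ≠ 0) {n : K} (hn : n ≠ 0)
    (h₁ : IsNormFrom a (-(n * b))) (h₂ : IsNormFrom (a * c) (n * a)) :
    ∃ x y z : K, a * x ^ 2 + b * y ^ 2 - a * b * z ^ 2 = c := by
  obtain ⟨x, w, h₂⟩ := h₂
  by_cases hw : w = 0
  · have hx : x ^ 2 = n * a := by linear_combination h₂ + a * c * w * hw
    have hx₀ : x / a ≠ 0 :=
      div_ne_zero (pow_ne_zero_iff two_ne_zero |>.1 (hx ▸ mul_ne_zero hn ha)) ha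
    have h : -(a * b) * (x / a) ^ 2 = -(n * b) := by
      rw [div_pow, hx]
      field_simp
    exact exists_pure_sq_eq ha hb
      ((neg_mul_self_right_iff ha).1 ((mul_sq_right_iff hx₀).1 (h ▸ h₁))) c
  · obtain ⟨y, z, h₁⟩ := h₁
    refine ⟨x / (a * w), y / (b * w), z / (b * w), ?_⟩
    field_simp
    linear_combination b * h₂ + a * h₁

end IsNormFrom

section BaseChange

open QuaternionAlgebra

variable {R : Type*} (S : Type*) [CommRing R] [CommRing S] [Algebra R S] (c₁ c₂ c₃ : R)

/-- A quaternion basis in an `S`-algebra whose parameters come from `R` is the same as a quaternion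
basis over `R`. -/
def quaternionBasisRestrictScalars (A : Type*) [Ring A] [Algebra R A] [Algebra S A]
    [IsScalarTower R S A] :
    Basis A (algebraMap R S c₁) (algebraMap R S c₂) (algebraMap R S c₃) ≃ Basis A c₁ c₂ c₃ where
  toFun q :=
    { i := q.i
      j := q.j
      k := q.k
      i_mul_i := by simpa only [algebraMap_smul] using q.i_mul_i
      j_mul_j := by simpa only [algebraMap_smul] using q.j_mul_j
      i_mul_j := q.i_mul_j
      j_mul_i := by simpa only [algebraMap_smul] using q.j_mul_i }
  invFun q :=
    { i := q.i
      j := q.j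
      k := q.k
      i_mul_i := by simpa only [algebraMap_smul] using q.i_mul_i
      j_mul_j := by simpa only [algebraMap_smul] using q.j_mul_j
      i_mul_j := q.i_mul_j
      j_mul_i := by simpa only [algebraMap_smul] using q.j_mul_i }

/-- The base change of a quaternion algebra is the quaternion algebra with the same parameters. -/
def quaternionBaseChangeEquiv : S ⊗[R] ℍ[R,c₁,c₂,c₃] ≃ₐ[S]
    ℍ[S,algebraMap R S c₁,algebraMap R S c₂,algebraMap R S c₃] :=
  AlgEquiv.ofAlgHom
    (Algebra.TensorProduct.lift (Algebra.ofId S _)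
      (quaternionBasisRestrictScalars S c₁ c₂ c₃ _ (Basis.self S)).liftHom
      fun s _ => Algebra.commutes s _)
    ((quaternionBasisRestrictScalars S c₁ c₂ c₃ _).symm
      ((Basis.self R).compHom Algebra.TensorProduct.includeRight)).liftHom
    (by ext <;> simp [quaternionBasisRestrictScalars, Basis.lift])
    (by ext <;> simp [quaternionBasisRestrictScalars, Basis.lift])

end BaseChange

section Splitting

open QuaternionAlgebra

variable {K : Type*} [Field K] {a b : K}

/-- The quaternion basis for `(a, x² - a y²)` in the `2 × 2` matrices: `i` is multiplication by `√a`
on `K(√a)`, and `j` is conjugation followed by multiplication by `x + y √a`. -/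
def matrixQuaternionBasis (a x y : K) :
    Basis (Matrix (Fin 2) (Fin 2) K) a 0 (x ^ 2 - a * y ^ 2) where
  i := !![0, a; 1, 0]
  j := !![x, -(a * y); y, -x]
  k := !![a * y, -(a * x); x, -(a * y)]
  i_mul_i := by ext i j; fin_cases i <;> fin_cases j <;> simp
  j_mul_j := by ext i j; fin_cases i <;> fin_cases j <;> simp <;> ring
  i_mul_j := by ext i j; fin_cases i <;> fin_cases j <;> simp
  j_mul_i := by ext i j; fin_cases i <;> fin_cases j <;> simp <;> ring

theorem matrixQuaternionBasis_liftHom_apply (a x y : K) (q : ℍ[K,a,x ^ 2 - a * y ^ 2]) :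
    (matrixQuaternionBasis a x y).liftHom q =
      !![q.re + x * q.imJ + a * y * q.imK, a * (q.imI - y * q.imJ - x * q.imK);
        q.imI + y * q.imJ + x * q.imK, q.re - x * q.imJ - a * y * q.imK] := by
  ext i j
  fin_cases i <;> fin_cases j <;>
    simp [Basis.liftHom, Basis.lift, matrixQuaternionBasis, Matrix.algebraMap_matrix_apply] <;> ring

theorem injective_matrixQuaternionBasis_liftHom [NeZero (2 : K)] {x y : K} (ha : a ≠ 0)
    (hb : x ^ 2 - a * y ^ 2 ≠ 0) :
    Function.Injective (matrixQuaternionBasis a x y).liftHom := by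
  rw [injective_iff_map_eq_zero]
  intro q hq
  rw [matrixQuaternionBasis_liftHom_apply] at hq
  have h2 : (2 : K) ≠ 0 := NeZero.ne 2
  have h00 : q.re + x * q.imJ + a * y * q.imK = 0 := congrFun₂ hq 0 0
  have h01 : q.imI - y * q.imJ - x * q.imK = 0 :=
    (mul_eq_zero.1 (congrFun₂ hq 0 1 : a * (q.imI - y * q.imJ - x * q.imK) = 0)).resolve_left ha
  have h10 : q.imI + y * q.imJ + x * q.imK = 0 := congrFun₂ hq 1 0
  have h11 : q.re - x * q.imJ - a * y * q.imK = 0 := congrFun₂ hq 1 1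
  have hdiag : x * q.imJ + a * y * q.imK = 0 :=
    mul_left_cancel₀ h2 (by linear_combination h00 - h11)
  have hskew : y * q.imJ + x * q.imK = 0 := mul_left_cancel₀ h2 (by linear_combination h10 - h01)
  ext
  · refine mul_left_cancel₀ h2 ?_
    simp only [re_zero]
    linear_combination h00 + h11
  · refine mul_left_cancel₀ h2 ?_
    simp only [imI_zero]
    linear_combination h01 + h10
  · refine mul_left_cancel₀ hb ?_
    simp only [imJ_zero]
    linear_combination x * hdiag - a * y * hskew
  · refine mul_left_cancel₀ hb ?_
    simp only [imK_zero]
    linear_combination x * hskew - y * hdiag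

theorem IsNormFrom.nonempty_algEquiv_matrix [NeZero (2 : K)] (ha : a ≠ 0) (hb : b ≠ 0)
    (h : IsNormFrom a b) : Nonempty (ℍ[K,a,b] ≃ₐ[K] Matrix (Fin 2) (Fin 2) K) := by
  obtain ⟨x, y, rfl⟩ := h
  have hinj := injective_matrixQuaternionBasis_liftHom ha hb
  have hrank : Module.finrank K ℍ[K,a,x ^ 2 - a * y ^ 2] =
      Module.finrank K (Matrix (Fin 2) (Fin 2) K) := by
    simp [QuaternionAlgebra.finrank_eq_four, Module.finrank_matrix]
  exact ⟨AlgEquiv.ofBijective _ ⟨hinj, (LinearMap.injective_iff_surjective_of_finrank_eq_finrank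
    (f := (matrixQuaternionBasis a x y).liftHom.toLinearMap) hrank).1 hinj⟩⟩

theorem isNormFrom_of_mul_self_eq_zero [NeZero (2 : K)] (ha : a ≠ 0) {q : ℍ[K,a,b]} (hq : q ≠ 0)
    (hqq : q * q = 0) : IsNormFrom a b := by
  set N := q.re ^ 2 - a * q.imI ^ 2 - b * q.imJ ^ 2 + a * b * q.imK ^ 2 with hN
  have hnorm : q * star q = algebraMap K _ N := by
    ext <;> simp [QuaternionAlgebra.algebraMap_eq, hN] <;> ring
  have hNq : N • q = 0 := by
    rw [Algebra.smul_def, Algebra.commutes, ← hnorm, ← mul_assoc, hqq, zero_mul]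
  refine .of_isotropic_normForm ha ((smul_eq_zero.1 hNq).resolve_right hq) ?_
  contrapose! hq
  ext <;> simp [hq]

theorem nonempty_algEquiv_matrix_iff [NeZero (2 : K)] (ha : a ≠ 0) (hb : b ≠ 0) :
    Nonempty (ℍ[K,a,b] ≃ₐ[K] Matrix (Fin 2) (Fin 2) K) ↔ IsNormFrom a b := by
  refine ⟨fun ⟨e⟩ => ?_, fun h => h.nonempty_algEquiv_matrix ha hb⟩
  have hE : (!![0, 1; 0, 0] : Matrix (Fin 2) (Fin 2) K) ≠ 0 := fun h => by
    simpa using congrFun₂ h 0 1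
  refine isNormFrom_of_mul_self_eq_zero ha (q := e.symm !![0, 1; 0, 0]) (by simpa using hE) ?_
  rw [← map_mul, map_eq_zero_iff _ e.symm.injective]
  ext i j
  fin_cases i <;> fin_cases j <;> simp

theorem splitsOver_iff_isNormFrom {a b : ℚ} (K : Type) [Field K] [Algebra ℚ K] (ha : a ≠ 0)
    (hb : b ≠ 0) : SplitsOver a b K ↔ IsNormFrom (a : K) (b : K) := by
  have : CharZero K := algebraRat.charZero K
  have e := quaternionBaseChangeEquiv K a 0 b
  rw [map_zero, eq_ratCast, eq_ratCast] at e
  rw [← nonempty_algEquiv_matrix_iff (Rat.cast_ne_zero.2 ha) (Rat.cast_ne_zero.2 hb)]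
  exact ⟨fun ⟨f⟩ => ⟨e.symm.trans f⟩, fun ⟨f⟩ => ⟨e.trans f⟩⟩

end Splitting

/-- A symmetric bimultiplicative pairing on the nonzero elements of `R` with values `±1`, such that
`a` is orthogonal to `-a`: the formal properties shared by all Hilbert symbols. Nothing is required
of `H a b` when `a` or `b` vanishes. -/
structure IsSymbol {R : Type*} [CommRing R] (H : R → R → ℤ) : Prop where
  comm : ∀ {a b : R}, a ≠ 0 → b ≠ 0 → H a b = H b a
  mul_left : ∀ {a a' b : R}, a ≠ 0 → a' ≠ 0 → b ≠ 0 → H (a * a') b = H a b * H a' b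
  eq_one_or : ∀ {a b : R}, a ≠ 0 → b ≠ 0 → H a b = 1 ∨ H a b = -1
  neg_self : ∀ {a : R}, a ≠ 0 → H a (-a) = 1

namespace IsSymbol

variable {R : Type*} [CommRing R] [IsDomain R] {H : R → R → ℤ} (hH : IsSymbol H) {a b c d n r : R}
include hH

theorem mul_right (ha : a ≠ 0) (hb : b ≠ 0) (hc : c ≠ 0) : H a (b * c) = H a b * H a c := by
  rw [hH.comm ha (mul_ne_zero hb hc), hH.mul_left hb hc ha, hH.comm hb ha, hH.comm hc ha]

omit [IsDomain R] in
theorem mul_self (ha : a ≠ 0) (hb : b ≠ 0) : H a b * H a b = 1 := by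
  rcases hH.eq_one_or ha hb with h | h <;> simp [h]

omit [IsDomain R] in
theorem eq_neg_one_of_ne_one (ha : a ≠ 0) (hb : b ≠ 0) (h : H a b ≠ 1) : H a b = -1 :=
  (hH.eq_one_or ha hb).resolve_left h

theorem mul_sq_left (ha : a ≠ 0) (hb : b ≠ 0) (hr : r ≠ 0) : H (a * r ^ 2) b = H a b := by
  rw [sq, hH.mul_left ha (mul_ne_zero hr hr) hb, hH.mul_left hr hr hb, hH.mul_self hr hb, mul_one]

theorem mul_sq_right (ha : a ≠ 0) (hb : b ≠ 0) (hr : r ≠ 0) : H a (b * r ^ 2) = H a b := by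
  rw [hH.comm ha (mul_ne_zero hb (pow_ne_zero 2 hr)), hH.mul_sq_left hb ha hr, hH.comm hb ha]

theorem one_left (ha : a ≠ 0) : H 1 a = 1 := by
  have h := hH.mul_left one_ne_zero one_ne_zero ha
  rwa [mul_one, hH.mul_self one_ne_zero ha] at h

theorem self_eq_neg_one_right (ha : a ≠ 0) : H a a = H a (-1) := by
  have h1 : (-1 : R) ≠ 0 := neg_ne_zero.2 one_ne_zero
  have h := hH.neg_self ha
  rw [← mul_neg_one a, hH.mul_right ha ha h1] at h
  calc H a a = H a a * H a (-1) * H a (-1) := by rw [mul_assoc, hH.mul_self ha h1, mul_one]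
    _ = H a (-1) := by rw [h, one_mul]

theorem exists_eq_neg_one_and_eq_one (ha : a ≠ 0) (hd : d ≠ 0) (hna : ∃ x ≠ 0, H x a = -1)
    (hnad : ∃ z ≠ 0, H z (a * d) = -1) : ∃ u ≠ 0, H u a = -1 ∧ H u d = 1 := by
  obtain ⟨x, hx, hxa⟩ := hna
  obtain ⟨z, hz, hzad⟩ := hnad
  rw [hH.mul_right hz ha hd] at hzad
  rcases hH.eq_one_or hz ha with hza | hza
  · rcases hH.eq_one_or hx hd with hxd | hxd
    · exact ⟨x, hx, hxa, hxd⟩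
    · refine ⟨x * z, mul_ne_zero hx hz, ?_, ?_⟩
      · rw [hH.mul_left hx hz ha, hxa, hza, mul_one]
      · rw [hza, one_mul] at hzad
        rw [hH.mul_left hx hz hd, hxd, hzad, neg_mul_neg, mul_one]
  · exact ⟨z, hz, hza, by rw [hza] at hzad; linarith⟩

theorem exists_eq_and_eq (ha : a ≠ 0) (hd : d ≠ 0) (hna : ∃ x ≠ 0, H x a = -1)
    (hnd : ∃ y ≠ 0, H y d = -1) (hnad : ∃ z ≠ 0, H z (a * d) = -1) {ε δ : ℤ}
    (hε : ε = 1 ∨ ε = -1) (hδ : δ = 1 ∨ δ = -1) : ∃ n ≠ 0, H n a = ε ∧ H n d = δ := by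
  obtain ⟨u, hu, hua, hud⟩ := hH.exists_eq_neg_one_and_eq_one ha hd hna hnad
  obtain ⟨v, hv, hvd, hva⟩ := hH.exists_eq_neg_one_and_eq_one hd ha hnd (mul_comm a d ▸ hnad)
  rcases hε with rfl | rfl <;> rcases hδ with rfl | rfl
  · exact ⟨1, one_ne_zero, hH.one_left ha, hH.one_left hd⟩
  · exact ⟨v, hv, hva, hvd⟩
  · exact ⟨u, hu, hua, hud⟩
  · refine ⟨u * v, mul_ne_zero hu hv, ?_, ?_⟩
    · rw [hH.mul_left hu hv ha, hua, hva, mul_one]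
    · rw [hH.mul_left hu hv hd, hud, hvd, one_mul]

theorem exists_common_slot (ha : a ≠ 0) (hb : b ≠ 0) (hc : c ≠ 0)
    (h : H a b = 1 ∨ ∃ m ≠ 0, H m c = -1) :
    ∃ n ≠ 0, H n a = H (-b) a ∧ H n (a * c) = H a (a * c) := by
  have hb' : -b ≠ 0 := neg_ne_zero.2 hb
  have hac := mul_ne_zero ha hc
  rcases hH.eq_one_or ha hb with hab | hab
  · have h1 : (-1 : R) ≠ 0 := neg_ne_zero.2 one_ne_zero
    refine ⟨a, ha, ?_, rfl⟩
    rw [hH.self_eq_neg_one_right ha, hH.comm hb' ha, ← mul_neg_one b, hH.mul_right ha hb h1, hab,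
      one_mul]
  · obtain ⟨m, hm, hmc⟩ := h.resolve_left (by rw [hab]; decide)
    by_cases htriv : ∀ n ≠ 0, H n (a * c) = 1
    · exact ⟨-b, hb', rfl, by rw [htriv _ hb', htriv _ ha]⟩
    · push Not at htriv
      obtain ⟨y, hy, hyac⟩ := htriv
      refine hH.exists_eq_and_eq ha hac ⟨b, hb, hH.comm hb ha ▸ hab⟩
        ⟨y, hy, hH.eq_neg_one_of_ne_one hy hac hyac⟩ ⟨m, hm, ?_⟩ (hH.eq_one_or hb' ha)
        (hH.eq_one_or ha hac)
      rw [show a * (a * c) = c * a ^ 2 by ring, hH.mul_sq_right hm hc ha, hmc]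

theorem eq_one_of_common_slot (ha : a ≠ 0) (hb : b ≠ 0) (hc : c ≠ 0) (hn : n ≠ 0)
    (h₁ : H n a = H (-b) a) (h₂ : H n (a * c) = H a (a * c)) :
    H a (-(n * b)) = 1 ∧ H (a * c) (n * a) = 1 := by
  have hb' : -b ≠ 0 := neg_ne_zero.2 hb
  have hac := mul_ne_zero ha hc
  constructor
  · rw [← mul_neg, hH.mul_right ha hn hb', hH.comm ha hn, h₁, hH.comm hb' ha, hH.mul_self ha hb']
  · rw [hH.mul_right hac hn ha, hH.comm hac hn, h₂, hH.comm hac ha, hH.mul_self ha hac]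

end IsSymbol

theorem finprod_eq_one_or_neg_one {ι : Type*} {f : ι → ℤ} (h : ∀ i, f i = 1 ∨ f i = -1) :
    ∏ᶠ i, f i = 1 ∨ ∏ᶠ i, f i = -1 := by
  refine finprod_induction (fun x : ℤ => x = 1 ∨ x = -1) (.inl rfl) ?_ h
  rintro x y (rfl | rfl) (rfl | rfl) <;> simp

theorem IsSymbol.finprod {ι R : Type*} [CommRing R] {H : ι → R → R → ℤ}
    (hH : ∀ i, IsSymbol (H i))
    (hfin : ∀ {a b : R}, a ≠ 0 → b ≠ 0 → (Function.mulSupport fun i => H i a b).Finite) :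
    IsSymbol fun a b => ∏ᶠ i, H i a b where
  comm ha hb := finprod_congr fun i => (hH i).comm ha hb
  mul_left ha ha' hb := by
    rw [← finprod_mul_distrib (hfin ha hb) (hfin ha' hb)]
    exact finprod_congr fun i => (hH i).mul_left ha ha' hb
  eq_one_or ha hb := finprod_eq_one_or_neg_one fun i => (hH i).eq_one_or ha hb
  neg_self ha := by simp only [(hH _).neg_self ha, finprod_one]

theorem induction_on_neg_one_primes {P : ℤ → Prop} (neg_one : P (-1))
    (prime : ∀ p : ℕ, p.Prime → P p) (mul : ∀ a b : ℤ, a ≠ 0 → b ≠ 0 → P a → P b → P (a * b))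
    {a : ℤ} (ha : a ≠ 0) : P a := by
  have one : P 1 := by simpa using mul (-1) (-1) (by simp) (by simp) neg_one neg_one
  have nat : ∀ n : ℕ, n ≠ 0 → P n := by
    intro n
    induction n using induction_on_primes with
    | zero => simp
    | one => simpa using one
    | prime_mul p n hp ih =>
      intro h
      have hn : n ≠ 0 := right_ne_zero_of_mul h
      push_cast
      exact mul _ _ (by exact_mod_cast hp.ne_zero) (by exact_mod_cast hn) (prime p hp) (ih hn)
  have habs := nat _ (Int.natAbs_ne_zero.2 ha)
  rcases Int.natAbs_eq a with h | h
  · rwa [h]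
  · rw [h, neg_eq_neg_one_mul]
    exact mul _ _ (by simp) (by simpa using ha) neg_one habs

namespace IsSymbol

variable {H : ℤ → ℤ → ℤ} (hH : IsSymbol H) {a b : ℤ}
include hH

theorem eq_one_of_generators_left (hb : b ≠ 0) (neg_one : H (-1) b = 1)
    (prime : ∀ p : ℕ, p.Prime → H p b = 1) (ha : a ≠ 0) : H a b = 1 :=
  induction_on_neg_one_primes (P := fun a => H a b = 1) neg_one prime
    (fun a a' ha ha' h h' => by rw [hH.mul_left ha ha' hb, h, h', one_mul]) ha

theorem eq_one_of_generators (neg_one_neg_one : H (-1) (-1) = 1)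
    (prime_neg_one : ∀ p : ℕ, p.Prime → H p (-1) = 1)
    (prime_prime : ∀ p q : ℕ, p.Prime → q.Prime → p ≠ q → H p q = 1) (ha : a ≠ 0) (hb : b ≠ 0) :
    H a b = 1 := by
  have neg_one_right {a : ℤ} (ha : a ≠ 0) : H a (-1) = 1 :=
    hH.eq_one_of_generators_left (by simp) neg_one_neg_one prime_neg_one ha
  refine hH.eq_one_of_generators_left hb (by rw [hH.comm (by simp) hb, neg_one_right hb])
    (fun p hp => ?_) ha
  have hp₀ : (p : ℤ) ≠ 0 := by exact_mod_cast hp.ne_zero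
  rw [hH.comm hp₀ hb]
  refine hH.eq_one_of_generators_left hp₀ (by rw [hH.comm (by simp) hp₀, neg_one_right hp₀])
    (fun q hq => ?_) hb
  obtain rfl | hqp := eq_or_ne q p
  · rw [hH.self_eq_neg_one_right hp₀, prime_neg_one q hq]
  · exact prime_prime q p hq hp hqp

end IsSymbol

section PrimeToPart

/-- The part of an integer that is prime to `p`. -/
def primeToPart (p : ℕ) (a : ℤ) : ℤ := a / (p : ℤ) ^ padicValInt p a

theorem pow_mul_primeToPart (p : ℕ) (a : ℤ) :
    (p : ℤ) ^ padicValInt p a * primeToPart p a = a :=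
  Int.mul_ediv_cancel' (padicValInt_dvd a)

variable {p : ℕ} [hp : Fact p.Prime] {a b u v : ℤ}

theorem not_dvd_primeToPart (ha : a ≠ 0) : ¬ (p : ℤ) ∣ primeToPart p a := by
  intro h
  have hd : (p : ℤ) ^ (padicValInt p a + 1) ∣ a := by
    conv_rhs => rw [← pow_mul_primeToPart p a]
    exact pow_succ (p : ℤ) _ ▸ mul_dvd_mul_left _ h
  have := (padicValInt_dvd_iff _ _).1 hd |>.resolve_left ha
  omega

theorem ne_zero_of_not_dvd {m : ℤ} (hu : ¬ m ∣ u) : u ≠ 0 := by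
  rintro rfl
  exact hu (dvd_zero m)

theorem not_dvd_mul (hu : ¬ (p : ℤ) ∣ u) (hv : ¬ (p : ℤ) ∣ v) : ¬ (p : ℤ) ∣ u * v :=
  fun h => ((Nat.prime_iff_prime_int.1 hp.out).dvd_or_dvd h).elim hu hv

theorem not_dvd_one : ¬ (p : ℤ) ∣ 1 := fun h =>
  hp.out.one_lt.ne' (Nat.dvd_one.1 (by exact_mod_cast h))

theorem not_dvd_neg_one : ¬ (p : ℤ) ∣ -1 := by
  rw [dvd_neg]
  exact not_dvd_one

theorem padicValInt_pow_mul (hu : ¬ (p : ℤ) ∣ u) (k : ℕ) :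
    padicValInt p ((p : ℤ) ^ k * u) = k := by
  have hp₀ : (p : ℤ) ≠ 0 := by exact_mod_cast hp.out.ne_zero
  induction k with
  | zero => simpa using padicValInt.eq_zero_of_not_dvd hu
  | succ k ih =>
    rw [pow_succ', mul_assoc,
      padicValInt.mul hp₀ (mul_ne_zero (pow_ne_zero _ hp₀) (ne_zero_of_not_dvd hu)), ih,
      padicValInt_self, add_comm]

theorem primeToPart_pow_mul (hu : ¬ (p : ℤ) ∣ u) (k : ℕ) :
    primeToPart p ((p : ℤ) ^ k * u) = u := by
  have hp₀ : (p : ℤ) ≠ 0 := by exact_mod_cast hp.out.ne_zero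
  rw [primeToPart, padicValInt_pow_mul hu, Int.mul_ediv_cancel_left _ (pow_ne_zero _ hp₀)]

theorem primeToPart_mul (ha : a ≠ 0) (hb : b ≠ 0) :
    primeToPart p (a * b) = primeToPart p a * primeToPart p b := by
  conv_lhs => rw [← pow_mul_primeToPart p a, ← pow_mul_primeToPart p b, mul_mul_mul_comm, ← pow_add]
  exact primeToPart_pow_mul (not_dvd_mul (not_dvd_primeToPart ha) (not_dvd_primeToPart hb)) _

theorem exists_eq_pow_mul_not_dvd (p : ℕ) [Fact p.Prime] (ha : a ≠ 0) :
    ∃ (k : ℕ) (u : ℤ), ¬ (p : ℤ) ∣ u ∧ a = (p : ℤ) ^ k * u :=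
  ⟨_, _, not_dvd_primeToPart ha, (pow_mul_primeToPart p a).symm⟩

end PrimeToPart

section HilbertSymbol

open ZMod
open scoped NumberTheorySymbols

/-- The Hilbert symbol over `ℝ`, on integers. -/
def realSymbol (a b : ℤ) : ℤ := if a < 0 ∧ b < 0 then -1 else 1

/-- The Hilbert symbol over `ℚ_p` for odd `p`, on integers: the Legendre symbol of the unit
`(-1)^(v(a) v(b)) a^(v(b)) / b^(v(a))`. -/
def tameSymbol (p : ℕ) (a b : ℤ) : ℤ :=
  J(-1 | p) ^ (padicValInt p a * padicValInt p b) * J(primeToPart p a | p) ^ padicValInt p b *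
    J(primeToPart p b | p) ^ padicValInt p a

/-- The Hilbert symbol over `ℚ_2`, on integers: for `a = 2^k u` and `b = 2^l v` with odd `u`, `v`
this is the sign with exponent `(u-1)/2 * (v-1)/2 + l (u²-1)/8 + k (v²-1)/8`. -/
def dyadicSymbol (a b : ℤ) : ℤ :=
  (if χ₄ (primeToPart 2 a) = -1 then χ₄ (primeToPart 2 b) else 1) *
    χ₈ (primeToPart 2 a) ^ padicValInt 2 b * χ₈ (primeToPart 2 b) ^ padicValInt 2 a

/-- The Hilbert symbol at a place of `ℚ`, on integers. Its values at zero are junk. -/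
def hilbertSymbol : RatPlace → ℤ → ℤ → ℤ
  | .infinite => realSymbol
  | .finite p => if (p : ℕ) = 2 then dyadicSymbol else tameSymbol p

theorem isSymbol_realSymbol : IsSymbol realSymbol where
  comm _ _ := by simp only [realSymbol, and_comm]
  mul_left {a a' b} ha ha' _ := by
    unfold realSymbol
    rcases ha.lt_or_gt with h | h <;> rcases ha'.lt_or_gt with h' | h' <;> by_cases hb : b < 0 <;>
      simp [hb, mul_neg_iff, h, h', h.not_gt, h'.not_gt]
  eq_one_or _ _ := by
    unfold realSymbol
    split_ifs <;> simp
  neg_self {a} _ := by rw [realSymbol, if_neg (by lia)]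

variable {p : ℕ} [hp : Fact p.Prime] {u v : ℤ}

theorem eq_one_or_neg_one_mul {x y : ℤ} (hx : x = 1 ∨ x = -1) (hy : y = 1 ∨ y = -1) :
    x * y = 1 ∨ x * y = -1 := by
  rcases hx with rfl | rfl <;> rcases hy with rfl | rfl <;> simp

theorem eq_one_or_neg_one_pow {x : ℤ} (hx : x = 1 ∨ x = -1) (n : ℕ) : x ^ n = 1 ∨ x ^ n = -1 := by
  rcases hx with rfl | rfl
  · simp
  · exact neg_one_pow_eq_or ℤ n

theorem χ₄_eq_one_or_neg_one (hu : ¬ 2 ∣ u) : χ₄ u = 1 ∨ χ₄ u = -1 := by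
  rw [χ₄_int_eq_if_mod_four, if_neg (by lia)]
  split_ifs <;> simp

theorem χ₈_eq_one_or_neg_one (hu : ¬ 2 ∣ u) : χ₈ u = 1 ∨ χ₈ u = -1 := by
  rw [χ₈_int_eq_if_mod_eight, if_neg (by lia)]
  split_ifs <;> simp

theorem jacobiSym_eq_one_or_neg_one (hu : ¬ (p : ℤ) ∣ u) : J(u | p) = 1 ∨ J(u | p) = -1 := by
  refine jacobiSym.eq_one_or_neg_one ?_
  rw [Int.gcd_comm, Int.gcd_eq_natAbs, Int.natAbs_natCast]
  exact (Nat.Prime.coprime_iff_not_dvd hp.out).2 (by rwa [← Int.natCast_dvd])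

theorem tameSymbol_pow_mul (hu : ¬ (p : ℤ) ∣ u) (hv : ¬ (p : ℤ) ∣ v) (k l : ℕ) :
    tameSymbol p ((p : ℤ) ^ k * u) ((p : ℤ) ^ l * v) =
      J(-1 | p) ^ (k * l) * J(u | p) ^ l * J(v | p) ^ k := by
  rw [tameSymbol, padicValInt_pow_mul hu, padicValInt_pow_mul hv, primeToPart_pow_mul hu,
    primeToPart_pow_mul hv]

theorem dyadicSymbol_pow_mul (hu : ¬ 2 ∣ u) (hv : ¬ 2 ∣ v) (k l : ℕ) :
    dyadicSymbol (2 ^ k * u) (2 ^ l * v) =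
      (if χ₄ u = -1 then χ₄ v else 1) * χ₈ u ^ l * χ₈ v ^ k := by
  have val {w : ℤ} (hw : ¬ 2 ∣ w) (m : ℕ) : padicValInt 2 (2 ^ m * w) = m :=
    padicValInt_pow_mul (p := 2) hw m
  have part {w : ℤ} (hw : ¬ 2 ∣ w) (m : ℕ) : primeToPart 2 (2 ^ m * w) = w :=
    primeToPart_pow_mul (p := 2) hw m
  rw [dyadicSymbol, val hu, val hv, part hu, part hv]

theorem isSymbol_tameSymbol (p : ℕ) [Fact p.Prime] : IsSymbol (tameSymbol p) where
  comm {a b} _ _ := by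
    simp only [tameSymbol, mul_comm (padicValInt p a)]
    ring
  mul_left ha ha' _ := by
    simp only [tameSymbol, primeToPart_mul ha ha', padicValInt.mul ha ha', jacobiSym.mul_left]
    ring
  eq_one_or ha hb := eq_one_or_neg_one_mul
    (eq_one_or_neg_one_mul
      (eq_one_or_neg_one_pow (jacobiSym_eq_one_or_neg_one not_dvd_neg_one) _)
      (eq_one_or_neg_one_pow (jacobiSym_eq_one_or_neg_one (not_dvd_primeToPart ha)) _))
    (eq_one_or_neg_one_pow (jacobiSym_eq_one_or_neg_one (not_dvd_primeToPart hb)) _)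
  neg_self ha := by
    obtain ⟨k, u, hu, rfl⟩ := exists_eq_pow_mul_not_dvd p ha
    rw [← mul_neg, tameSymbol_pow_mul hu (by rwa [dvd_neg]), ← neg_one_mul u, jacobiSym.mul_left,
      mul_pow]
    calc J(-1 | p) ^ (k * k) * J(u | p) ^ k * (J(-1 | p) ^ k * J(u | p) ^ k)
        = J(-1 | p) ^ (k * (k + 1)) * (J(u | p) ^ 2) ^ k := by ring
      _ = 1 := by
        have hsq : J(u | p) ^ 2 = 1 := by
          rcases jacobiSym_eq_one_or_neg_one hu with h | h <;> simp [h]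
        rcases jacobiSym_eq_one_or_neg_one (p := p) not_dvd_neg_one with h | h <;>
          simp [h, hsq, (Nat.even_mul_succ_self k).neg_one_pow]

theorem isSymbol_dyadicSymbol : IsSymbol dyadicSymbol where
  comm ha hb := by
    rcases χ₄_eq_one_or_neg_one (not_dvd_primeToPart (p := 2) ha) with h | h <;>
    rcases χ₄_eq_one_or_neg_one (not_dvd_primeToPart (p := 2) hb) with h' | h' <;>
      simp [dyadicSymbol, h, h', mul_comm]
  mul_left ha ha' hb := by
    simp only [dyadicSymbol, primeToPart_mul ha ha', padicValInt.mul ha ha', Int.cast_mul, map_mul]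
    rcases χ₄_eq_one_or_neg_one (not_dvd_primeToPart (p := 2) ha) with h | h <;>
    rcases χ₄_eq_one_or_neg_one (not_dvd_primeToPart (p := 2) ha') with h' | h' <;>
    rcases χ₄_eq_one_or_neg_one (not_dvd_primeToPart (p := 2) hb) with h'' | h'' <;>
      simp [h, h', h''] <;> ring
  eq_one_or ha hb := by
    have hu := not_dvd_primeToPart (p := 2) ha
    have hv := not_dvd_primeToPart (p := 2) hb
    refine eq_one_or_neg_one_mul (eq_one_or_neg_one_mul ?_
      (eq_one_or_neg_one_pow (χ₈_eq_one_or_neg_one hu) _))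
      (eq_one_or_neg_one_pow (χ₈_eq_one_or_neg_one hv) _)
    split_ifs
    · exact χ₄_eq_one_or_neg_one hv
    · exact .inl rfl
  neg_self ha := by
    obtain ⟨k, u, hu, rfl⟩ := exists_eq_pow_mul_not_dvd 2 ha
    rw [Nat.cast_ofNat] at hu ⊢
    rw [← mul_neg, dyadicSymbol_pow_mul hu (by rwa [dvd_neg])]
    have h4 : χ₄ ((-1 : ℤ) : ZMod 4) = -1 := by decide
    have h8 : χ₈ ((-1 : ℤ) : ZMod 8) = 1 := by decide
    rw [← neg_one_mul u, Int.cast_mul, Int.cast_mul, map_mul, map_mul, h4, h8, one_mul]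
    rcases χ₄_eq_one_or_neg_one hu with h | h <;> rcases χ₈_eq_one_or_neg_one hu with h' | h' <;>
      simp [h, h', ← mul_pow]

/-- Makes the completions of `ℚ` at the elements of `Nat.Primes` available. -/
instance factPrimeOfPrimes (p : Nat.Primes) : Fact (p : ℕ).Prime := ⟨p.2⟩

theorem isSymbol_hilbertSymbol : ∀ v : RatPlace, IsSymbol (hilbertSymbol v)
  | .infinite => isSymbol_realSymbol
  | .finite p => by
    simp only [hilbertSymbol]
    split_ifs
    exacts [isSymbol_dyadicSymbol, isSymbol_tameSymbol p]

theorem tameSymbol_of_not_dvd (hu : ¬ (p : ℤ) ∣ u) (hv : ¬ (p : ℤ) ∣ v) : tameSymbol p u v = 1 := by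
  simpa using tameSymbol_pow_mul hu hv 0 0

theorem tameSymbol_prime_right (hu : ¬ (p : ℤ) ∣ u) : tameSymbol p u p = J(u | p) := by
  simpa using tameSymbol_pow_mul hu not_dvd_one 0 1

theorem dyadicSymbol_of_not_dvd (hu : ¬ 2 ∣ u) (hv : ¬ 2 ∣ v) :
    dyadicSymbol u v = if χ₄ u = -1 then χ₄ v else 1 := by
  simpa using dyadicSymbol_pow_mul hu hv 0 0

theorem dyadicSymbol_two_left (hu : ¬ 2 ∣ u) : dyadicSymbol 2 u = χ₈ u := by
  simpa using dyadicSymbol_pow_mul (u := 1) (by decide) hu 1 0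

theorem hilbertSymbol_of_not_dvd {p : Nat.Primes} (hp : (p : ℕ) ≠ 2) (hu : ¬ (p : ℤ) ∣ u)
    (hv : ¬ (p : ℤ) ∣ v) : hilbertSymbol (.finite p) u v = 1 := by
  rw [hilbertSymbol, if_neg hp, tameSymbol_of_not_dvd hu hv]

theorem tameSymbol_congr (h : u ≡ v [ZMOD p]) (hu : ¬ (p : ℤ) ∣ u) (k : ℕ) (b : ℤ) :
    tameSymbol p ((p : ℤ) ^ k * u) b = tameSymbol p ((p : ℤ) ^ k * v) b := by
  have hv : ¬ (p : ℤ) ∣ v := fun hv => hu (h.dvd_iff.2 hv)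
  simp only [tameSymbol, padicValInt_pow_mul hu, padicValInt_pow_mul hv, primeToPart_pow_mul hu,
    primeToPart_pow_mul hv, jacobiSym.mod_left' h]

theorem dyadicSymbol_congr (h : u ≡ v [ZMOD 8]) (hu : ¬ 2 ∣ u) (k : ℕ) (b : ℤ) :
    dyadicSymbol (2 ^ k * u) b = dyadicSymbol (2 ^ k * v) b := by
  have hv : ¬ 2 ∣ v := fun hv => hu ((h.of_dvd (by norm_num : (2 : ℤ) ∣ 8)).dvd_iff.2 hv)
  have val {w : ℤ} (hw : ¬ 2 ∣ w) : padicValInt 2 (2 ^ k * w) = k :=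
    padicValInt_pow_mul (p := 2) hw k
  have part {w : ℤ} (hw : ¬ 2 ∣ w) : primeToPart 2 (2 ^ k * w) = w :=
    primeToPart_pow_mul (p := 2) hw k
  simp only [dyadicSymbol, val hu, val hv, part hu, part hv, (intCast_eq_intCast_iff u v 8).2 h,
    (intCast_eq_intCast_iff u v 4).2 (h.of_dvd (by norm_num))]

theorem hilbertSymbol_finite_congr {p : Nat.Primes} {m n : ℤ} (hm : m ≠ 0)
    (h : n ≡ m [ZMOD (p : ℤ) ^ (padicValInt p m + 3)]) (b : ℤ) :
    hilbertSymbol (.finite p) n b = hilbertSymbol (.finite p) m b := by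
  obtain ⟨k, u, hu, rfl⟩ := exists_eq_pow_mul_not_dvd p hm
  rw [padicValInt_pow_mul hu] at h
  obtain ⟨c, hc⟩ := h.symm.dvd
  obtain rfl : n = (p : ℤ) ^ k * (u + p ^ 3 * c) := by linear_combination hc
  have hmod : u ≡ u + p ^ 3 * c [ZMOD p ^ 3] := Int.modEq_iff_dvd.2 ⟨c, by ring⟩
  simp only [hilbertSymbol]
  split_ifs with h2
  · rw [h2] at hu hmod ⊢
    exact (dyadicSymbol_congr hmod hu k b).symm
  · exact (tameSymbol_congr (hmod.of_dvd (dvd_pow_self _ three_ne_zero)) hu k b).symm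

end HilbertSymbol

section ProductFormula

open ZMod Finset
open scoped NumberTheorySymbols

theorem finprod_ratPlace {f : RatPlace → ℤ} (s : Finset Nat.Primes)
    (h : ∀ p ∉ s, f (.finite p) = 1) :
    ∏ᶠ v, f v = f .infinite * ∏ p ∈ s, f (.finite p) := by
  let finite : Nat.Primes ↪ RatPlace := ⟨.finite, fun _ _ h => RatPlace.finite.inj h⟩
  have hnot : RatPlace.infinite ∉ s.map finite := by simp [finite]
  rw [finprod_eq_prod_of_mulSupport_subset (s := (s.map finite).cons _ hnot) f, prod_cons, prod_map]
  · rfl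
  rintro (_ | p) hp
  · simp
  · have : p ∈ s := by_contra fun hps => hp (h p hps)
    exact mem_coe.2 (mem_cons_of_mem (mem_map_of_mem finite this))

theorem finprod_hilbertSymbol_eq {a b : ℤ} (s : Finset Nat.Primes)
    (h : ∀ p ∉ s, (p : ℕ) ≠ 2 ∧ ¬ (p : ℤ) ∣ a ∧ ¬ (p : ℤ) ∣ b) :
    ∏ᶠ v, hilbertSymbol v a b = realSymbol a b * ∏ p ∈ s, hilbertSymbol (.finite p) a b :=
  finprod_ratPlace s fun p hp => hilbertSymbol_of_not_dvd (h p hp).1 (h p hp).2.1 (h p hp).2.2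

theorem exists_finset_primes_dvd {a : ℤ} (ha : a ≠ 0) :
    ∃ s : Finset Nat.Primes, ∀ p : Nat.Primes, p ∈ s ↔ (p : ℤ) ∣ a := by
  refine ⟨a.natAbs.primeFactors.subtype Nat.Prime, fun p => mem_subtype.trans ?_⟩
  rw [Nat.mem_primeFactors_of_ne_zero (Int.natAbs_ne_zero.2 ha), Int.natCast_dvd]
  exact and_iff_right p.2

theorem finite_mulSupport_hilbertSymbol {a b : ℤ} (ha : a ≠ 0) (hb : b ≠ 0) :
    (Function.mulSupport fun v => hilbertSymbol v a b).Finite := by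
  obtain ⟨s, hs⟩ := exists_finset_primes_dvd (mul_ne_zero two_ne_zero (mul_ne_zero ha hb))
  refine ((s.finite_toSet.image RatPlace.finite).insert .infinite).subset ?_
  rintro (_ | p) hp
  · simp
  · refine .inr ⟨p, (hs p).2 (by_contra fun h => hp (hilbertSymbol_of_not_dvd ?_ ?_ ?_)), rfl⟩
    · rintro h2
      exact h (by simp [h2])
    · exact fun h' => h (dvd_mul_of_dvd_right (dvd_mul_of_dvd_left h' _) _)
    · exact fun h' => h (dvd_mul_of_dvd_right (dvd_mul_of_dvd_right h' _) _)

theorem isSymbol_finprod_hilbertSymbol : IsSymbol fun a b => ∏ᶠ v, hilbertSymbol v a b :=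
  .finprod isSymbol_hilbertSymbol finite_mulSupport_hilbertSymbol

theorem realSymbol_natCast_right (a : ℤ) (n : ℕ) : realSymbol a n = 1 := by
  simp [realSymbol]

theorem prime_not_dvd_prime {p q : Nat.Primes} (h : p ≠ q) : ¬ (p : ℤ) ∣ q := by
  rw [Int.natCast_dvd_natCast, Nat.prime_dvd_prime_iff_eq p.2 q.2]
  exact fun h' => h (Subtype.ext h')

/-- The place `2`, singled out because the Hilbert symbol there is not tame. -/
def primeTwo : Nat.Primes := ⟨2, Nat.prime_two⟩

@[simp]
theorem coe_primeTwo : (primeTwo : ℕ) = 2 := rfl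

theorem coe_ne_two {p : Nat.Primes} (hp : p ≠ primeTwo) : (p : ℕ) ≠ 2 :=
  fun h => hp (Subtype.ext h)

theorem hilbertSymbol_two (a b : ℤ) : hilbertSymbol (.finite primeTwo) a b = dyadicSymbol a b := by
  simp [hilbertSymbol]

theorem hilbertSymbol_odd {p : Nat.Primes} (hp : p ≠ primeTwo) (a b : ℤ) :
    hilbertSymbol (.finite p) a b = tameSymbol p a b := by
  simp [hilbertSymbol, coe_ne_two hp]

theorem finprod_hilbertSymbol_neg_one_neg_one : ∏ᶠ v, hilbertSymbol v (-1) (-1) = 1 := by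
  rw [finprod_hilbertSymbol_eq {primeTwo} fun p hp =>
      ⟨coe_ne_two (by simpa using hp), not_dvd_neg_one, not_dvd_neg_one⟩, prod_singleton,
    hilbertSymbol_two, dyadicSymbol_of_not_dvd (by decide) (by decide)]
  decide

theorem finprod_hilbertSymbol_two_neg_one : ∏ᶠ v, hilbertSymbol v 2 (-1) = 1 := by
  have two_not_dvd {p : Nat.Primes} (hp : p ∉ ({primeTwo} : Finset _)) : ¬ (p : ℤ) ∣ 2 :=
    prime_not_dvd_prime (q := primeTwo) (by simpa using hp)
  rw [finprod_hilbertSymbol_eq {primeTwo} fun p hp =>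
      ⟨coe_ne_two (by simpa using hp), two_not_dvd hp, not_dvd_neg_one⟩, prod_singleton,
    hilbertSymbol_two, dyadicSymbol_two_left (by decide)]
  decide

section OddPrime

variable {p q : Nat.Primes} (hq : q ≠ primeTwo) {a : ℤ}
include hq

theorem odd_of_ne_two : Odd (q : ℕ) := q.2.odd_of_ne_two (coe_ne_two hq)

theorem not_two_dvd_prime : ¬ (2 : ℤ) ∣ q := prime_not_dvd_prime (p := primeTwo) hq.symm

theorem finprod_hilbertSymbol_prime_right
    (ha : ∀ p : Nat.Primes, p ≠ primeTwo → ¬ (p : ℤ) ∣ a) :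
    ∏ᶠ v, hilbertSymbol v a q = dyadicSymbol a q * J(a | q) := by
  rw [finprod_hilbertSymbol_eq {primeTwo, q} fun p hp => ?_, prod_pair hq.symm,
    realSymbol_natCast_right, one_mul, hilbertSymbol_two, hilbertSymbol_odd hq,
    tameSymbol_prime_right (ha q hq)]
  simp only [mem_insert, mem_singleton, not_or] at hp
  exact ⟨coe_ne_two hp.1, ha p hp.1, prime_not_dvd_prime hp.2⟩

theorem finprod_hilbertSymbol_neg_one_prime : ∏ᶠ v, hilbertSymbol v (-1) q = 1 := by
  have h2 := not_two_dvd_prime hq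
  have h4 : χ₄ ((-1 : ℤ) : ZMod 4) = -1 := by decide
  rw [finprod_hilbertSymbol_prime_right hq fun p _ => not_dvd_neg_one,
    dyadicSymbol_of_not_dvd (by decide) h2, if_pos h4, jacobiSym.at_neg_one (odd_of_ne_two hq)]
  rcases χ₄_eq_one_or_neg_one h2 with h | h <;> rw [Int.cast_natCast] at h <;> simp [h]

theorem finprod_hilbertSymbol_two_prime : ∏ᶠ v, hilbertSymbol v 2 q = 1 := by
  have h2 := not_two_dvd_prime hq
  have ha (p : Nat.Primes) (hp : p ≠ primeTwo) : ¬ (p : ℤ) ∣ 2 :=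
    prime_not_dvd_prime (q := primeTwo) hp
  rw [finprod_hilbertSymbol_prime_right hq ha, dyadicSymbol_two_left h2,
    jacobiSym.at_two (odd_of_ne_two hq)]
  rcases χ₈_eq_one_or_neg_one h2 with h | h <;> rw [Int.cast_natCast] at h <;> simp [h]

theorem finprod_hilbertSymbol_prime_prime (hp : p ≠ primeTwo) (hpq : p ≠ q) :
    ∏ᶠ v, hilbertSymbol v p q = 1 := by
  have hp' := odd_of_ne_two hp
  have hq' := odd_of_ne_two hq
  rw [finprod_hilbertSymbol_eq {primeTwo, p, q} fun r hr => ?_,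
    prod_insert (by simp [hp.symm, hq.symm]), prod_pair hpq, realSymbol_natCast_right,
    one_mul, hilbertSymbol_two, hilbertSymbol_odd hp, hilbertSymbol_odd hq,
    tameSymbol_prime_right (prime_not_dvd_prime hpq.symm),
    (isSymbol_tameSymbol p).comm (by simp [p.2.ne_zero]) (by simp [q.2.ne_zero]),
    tameSymbol_prime_right (prime_not_dvd_prime hpq),
    dyadicSymbol_of_not_dvd (not_two_dvd_prime hp) (not_two_dvd_prime hq), Int.cast_natCast,
    Int.cast_natCast]
  · have hJ := jacobiSym_eq_one_or_neg_one (prime_not_dvd_prime hpq)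
    rcases Nat.odd_mod_four_iff.1 (Nat.odd_iff.1 hp') with hm | hm
    · rw [χ₄_nat_one_mod_four hm, jacobiSym.quadratic_reciprocity_one_mod_four hm hq']
      rcases hJ with h | h <;> simp [h]
    · rw [χ₄_nat_three_mod_four hm]
      rcases Nat.odd_mod_four_iff.1 (Nat.odd_iff.1 hq') with hm' | hm'
      · rw [χ₄_nat_one_mod_four hm', jacobiSym.quadratic_reciprocity_one_mod_four' hp' hm']
        rcases hJ with h | h <;> simp [h]
      · rw [χ₄_nat_three_mod_four hm', jacobiSym.quadratic_reciprocity_three_mod_four hm hm']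
        rcases hJ with h | h <;> simp [h]
  · simp only [mem_insert, mem_singleton, not_or] at hr
    exact ⟨coe_ne_two hr.1, prime_not_dvd_prime hr.2.1, prime_not_dvd_prime hr.2.2⟩

end OddPrime

theorem finprod_hilbertSymbol {a b : ℤ} (ha : a ≠ 0) (hb : b ≠ 0) :
    ∏ᶠ v, hilbertSymbol v a b = 1 := by
  have hH := isSymbol_finprod_hilbertSymbol
  have ne_zero (p : Nat.Primes) : ((p : ℕ) : ℤ) ≠ 0 := by exact_mod_cast p.2.ne_zero
  refine hH.eq_one_of_generators finprod_hilbertSymbol_neg_one_neg_one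
    (fun p hp => ?_) (fun p q hp hq hpq => ?_) ha hb
  · obtain ⟨p, rfl⟩ : ∃ p' : Nat.Primes, (p' : ℕ) = p := ⟨⟨p, hp⟩, rfl⟩
    obtain rfl | h2 := eq_or_ne p primeTwo
    · exact finprod_hilbertSymbol_two_neg_one
    · exact (hH.comm (ne_zero p) (by simp)).trans (finprod_hilbertSymbol_neg_one_prime h2)
  · obtain ⟨p, rfl⟩ : ∃ p' : Nat.Primes, (p' : ℕ) = p := ⟨⟨p, hp⟩, rfl⟩
    obtain ⟨q, rfl⟩ : ∃ q' : Nat.Primes, (q' : ℕ) = q := ⟨⟨q, hq⟩, rfl⟩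
    replace hpq : p ≠ q := fun h => hpq (congrArg _ h)
    obtain rfl | hp2 := eq_or_ne p primeTwo
    · exact finprod_hilbertSymbol_two_prime hpq.symm
    · obtain rfl | hq2 := eq_or_ne q primeTwo
      · exact (hH.comm (ne_zero p) (by simp)).trans (finprod_hilbertSymbol_two_prime hpq)
      · exact finprod_hilbertSymbol_prime_prime hq2 hp2 hpq

theorem hilbertSymbol_eq_one_of_forall_ne {a b : ℤ} (ha : a ≠ 0) (hb : b ≠ 0) {w : RatPlace}
    (h : ∀ v ≠ w, hilbertSymbol v a b = 1) : hilbertSymbol w a b = 1 := by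
  rw [← finprod_hilbertSymbol ha hb, finprod_eq_single _ w h]

end ProductFormula

/-- The symbol `H` decides whether the quaternion algebra `(a, b)` over `K` splits. -/
def SymbolDetects (K : Type*) [Field K] (H : ℤ → ℤ → ℤ) (a b : ℤ) : Prop :=
  IsNormFrom (a : K) (b : K) ↔ H a b = 1

namespace SymbolDetects

variable {K : Type*} [Field K] [CharZero K] {H : ℤ → ℤ → ℤ} (hH : IsSymbol H) {a b r : ℤ}
include hH

theorem symm (ha : a ≠ 0) (hb : b ≠ 0) (h : SymbolDetects K H a b) : SymbolDetects K H b a := by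
  rwa [SymbolDetects, IsNormFrom.comm (by exact_mod_cast hb) (by exact_mod_cast ha),
    hH.comm hb ha]

theorem mul_sq_left (ha : a ≠ 0) (hb : b ≠ 0) (hr : r ≠ 0) (h : SymbolDetects K H a b) :
    SymbolDetects K H (a * r ^ 2) b := by
  rw [SymbolDetects, hH.mul_sq_left ha hb hr]
  push_cast
  rwa [IsNormFrom.mul_sq_left_iff (by exact_mod_cast hr)]

theorem of_neg_mul_self (ha : a ≠ 0) (hb : b ≠ 0) (h : SymbolDetects K H a (-(a * b))) :
    SymbolDetects K H a b := by
  rw [SymbolDetects, ← neg_mul, hH.mul_right ha (neg_ne_zero.2 ha) hb, hH.neg_self ha,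
    one_mul] at h
  push_cast at h
  rwa [neg_mul, IsNormFrom.neg_mul_self_right_iff (by exact_mod_cast ha)] at h

variable {p : ℕ} [hp : Fact p.Prime]

theorem of_not_dvd_of_mul (ha : a ≠ 0) (hb : b ≠ 0)
    (h : ∀ u : ℤ, ¬ (p : ℤ) ∣ u → SymbolDetects K H u b ∧ SymbolDetects K H (p * u) b) :
    SymbolDetects K H a b := by
  have hp₀ : (p : ℤ) ≠ 0 := by exact_mod_cast hp.out.ne_zero
  obtain ⟨k, u, hu, rfl⟩ := exists_eq_pow_mul_not_dvd p ha
  have hu₀ := ne_zero_of_not_dvd hu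
  obtain ⟨j, rfl | rfl⟩ := Nat.even_or_odd' k
  · rw [show (p : ℤ) ^ (2 * j) * u = u * ((p : ℤ) ^ j) ^ 2 by ring]
    exact (h u hu).1.mul_sq_left hH hu₀ hb (pow_ne_zero j hp₀)
  · rw [show (p : ℤ) ^ (2 * j + 1) * u = p * u * ((p : ℤ) ^ j) ^ 2 by ring]
    exact (h u hu).2.mul_sq_left hH (mul_ne_zero hp₀ hu₀) hb (pow_ne_zero j hp₀)

theorem of_units (ha : a ≠ 0) (hb : b ≠ 0)
    (h₀ : ∀ u v : ℤ, ¬ (p : ℤ) ∣ u → ¬ (p : ℤ) ∣ v → SymbolDetects K H u v)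
    (h₁ : ∀ u v : ℤ, ¬ (p : ℤ) ∣ u → ¬ (p : ℤ) ∣ v → SymbolDetects K H u (p * v)) :
    SymbolDetects K H a b := by
  have hp₀ : (p : ℤ) ≠ 0 := by exact_mod_cast hp.out.ne_zero
  refine of_not_dvd_of_mul (p := p) hH ha hb fun u hu => ?_
  have hu₀ := ne_zero_of_not_dvd hu
  have hpu := mul_ne_zero hp₀ hu₀
  constructor
  · refine (of_not_dvd_of_mul (p := p) hH hb hu₀ fun v hv => ⟨h₀ v u hv hu, ?_⟩).symm hH hb hu₀
    exact (h₁ u v hu hv).symm hH hu₀ (mul_ne_zero hp₀ (ne_zero_of_not_dvd hv))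
  · refine (of_not_dvd_of_mul (p := p) hH hb hpu fun v hv => ⟨h₁ v u hv hu, ?_⟩).symm hH hb hpu
    have hpv := mul_ne_zero hp₀ (ne_zero_of_not_dvd hv)
    have huv : ¬ (p : ℤ) ∣ -(v * u) := by
      rw [dvd_neg]
      exact not_dvd_mul hv hu
    have huv₀ := ne_zero_of_not_dvd huv
    refine of_neg_mul_self hH hpv hpu ?_
    rw [show -(p * v * (p * u)) = -(v * u) * (p : ℤ) ^ 2 by ring]
    exact ((h₁ _ v huv hv).mul_sq_left hH huv₀ hpv hp₀).symm hH
      (mul_ne_zero huv₀ (pow_ne_zero 2 hp₀)) hpv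

end SymbolDetects

section Padic

open ZMod
open scoped NumberTheorySymbols

variable {p : ℕ} [hp : Fact p.Prime]

theorem isSquare_one_add_four_mul {w : ℚ_[p]} (hw : ‖w‖ < 1) : IsSquare (1 + 4 * w) := by
  let W : ℤ_[p] := ⟨w, hw.le⟩
  have hW : ‖W‖ < 1 := hw
  let F : Polynomial ℤ_[p] := .X ^ 2 + .X - .C W
  obtain ⟨z, hz, -⟩ := hensels_lemma (F := F) (a := (0 : ℤ_[p])) (by simpa [F] using hW)
  have hz' : (z : ℚ_[p]) ^ 2 + z = w := by
    simpa [F, sub_eq_zero] using congrArg (fun t : ℤ_[p] => (t : ℚ_[p]) + w) hz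
  exact ⟨1 + 2 * z, by rw [← hz']; ring⟩

theorem exists_eq_mul_sq {m n : ℚ_[p]} (h : ‖n - m‖ < ‖4 * m‖) : ∃ r ≠ 0, n = m * r ^ 2 := by
  have hm : 4 * m ≠ 0 := norm_pos_iff.1 ((norm_nonneg _).trans_lt h)
  have hw : ‖(n - m) / (4 * m)‖ < 1 := by rwa [norm_div, div_lt_one (norm_pos_iff.2 hm)]
  obtain ⟨r, hr⟩ := isSquare_one_add_four_mul hw
  have hn : n = m * r ^ 2 := by
    rw [sq, ← hr]
    field_simp [right_ne_zero_of_mul hm]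
    ring
  refine ⟨r, ?_, hn⟩
  rintro rfl
  have h4 : ‖(4 : ℚ_[p])‖ ≤ 1 := by exact_mod_cast Padic.norm_int_le_one (p := p) 4
  rw [hn, zero_pow two_ne_zero, mul_zero, zero_sub, norm_neg, norm_mul] at h
  nlinarith [norm_nonneg m]

theorem exists_eq_mul_sq_of_dvd_sub {m n : ℤ} (k : ℕ) (hm : ¬ (p : ℤ) ^ k ∣ 4 * m)
    (h : (p : ℤ) ^ k ∣ n - m) : ∃ r : ℚ_[p], r ≠ 0 ∧ (n : ℚ_[p]) = m * r ^ 2 := by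
  rw [← Padic.norm_int_le_pow_iff_dvd] at hm h
  push_cast at hm h
  exact exists_eq_mul_sq (h.trans_lt (not_le.1 hm))

theorem isSquare_intCast_of_dvd_sub_sq {a x : ℤ} (k : ℕ) (hx : ¬ (p : ℤ) ^ k ∣ 4 * x ^ 2)
    (h : (p : ℤ) ^ k ∣ a - x ^ 2) : IsSquare (a : ℚ_[p]) := by
  obtain ⟨r, -, hr⟩ := exists_eq_mul_sq_of_dvd_sub k hx h
  exact ⟨x * r, by rw [hr]; push_cast; ring⟩

theorem isNormFrom_of_dvd_sub {a b x y : ℤ} (k : ℕ) (hb : ¬ (p : ℤ) ^ k ∣ 4 * b)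
    (h : (p : ℤ) ^ k ∣ x ^ 2 - a * y ^ 2 - b) : IsNormFrom (a : ℚ_[p]) (b : ℚ_[p]) := by
  obtain ⟨r, hr, h⟩ := exists_eq_mul_sq_of_dvd_sub k hb h
  exact (IsNormFrom.mul_sq_right_iff hr).1 ⟨x, y, by rw [← h]; push_cast; ring⟩

theorem exists_primitive_scaling {ι : Type*} [Finite ι] {t : ι → ℚ_[p]} (ht : t ≠ 0) :
    ∃ m ≠ 0, ∃ T : ι → ℤ_[p], (∀ i, t i = m * T i) ∧ ∃ i, T i = 1 := by
  obtain ⟨j, hj⟩ := Function.ne_iff.1 ht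
  have : Nonempty ι := ⟨j⟩
  obtain ⟨i, hi⟩ := Finite.exists_max fun k => ‖t k‖
  have hti : 0 < ‖t i‖ := (norm_pos_iff.2 hj).trans_le (hi j)
  refine ⟨t i, norm_pos_iff.1 hti,
    fun k => ⟨t k / t i, by rw [norm_div]; exact (div_le_one hti).2 (hi k)⟩, fun k => ?_, i, ?_⟩
  · exact (mul_div_cancel₀ _ (norm_pos_iff.1 hti)).symm
  · exact PadicInt.ext (div_self (norm_pos_iff.1 hti))

theorem exists_primitive_of_isNormFrom {a b : ℤ} (h : IsNormFrom (a : ℚ_[p]) (b : ℚ_[p])) :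
    ∃ X Y Z : ℤ_[p], X ^ 2 - a * Y ^ 2 = b * Z ^ 2 ∧ (X = 1 ∨ Y = 1 ∨ Z = 1) := by
  obtain ⟨x, y, h⟩ := h
  obtain ⟨m, hm, T, hT, hone⟩ := exists_primitive_scaling (t := ![x, y, 1]) fun h0 => by
    simpa using congrFun h0 2
  refine ⟨T 0, T 1, T 2, PadicInt.ext (mul_left_cancel₀ (pow_ne_zero 2 hm) ?_), ?_⟩
  · have hx : x = m * T 0 := hT 0
    have hy : y = m * T 1 := hT 1
    have hz : 1 = m * T 2 := hT 2
    push_cast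
    linear_combination (x + m * T 0) * hx.symm - a * (y + m * T 1) * hy.symm + h
      - b * (1 + m * T 2) * hz.symm
  · simpa [Fin.exists_fin_succ] using hone

theorem not_dvd_four (hp₂ : p ≠ 2) : ¬ (p : ℤ) ∣ 4 := by
  have h2 : ¬ (p : ℤ) ∣ 2 := by
    exact_mod_cast fun h => hp₂ ((Nat.prime_dvd_prime_iff_eq hp.out Nat.prime_two).1 h)
  exact not_dvd_mul h2 h2

theorem isSquare_of_jacobiSym_eq_one (hp₂ : p ≠ 2) {u : ℤ} (hu : ¬ (p : ℤ) ∣ u)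
    (h : J(u | p) = 1) : IsSquare (u : ℚ_[p]) := by
  obtain ⟨x, hx⟩ := ZMod.isSquare_of_jacobiSym_eq_one h
  obtain ⟨x, rfl⟩ := ZMod.intCast_surjective x
  have hd : (p : ℤ) ∣ u - x ^ 2 := by
    rw [← ZMod.intCast_zmod_eq_zero_iff_dvd]
    push_cast
    rw [hx, sq, sub_self]
  have hx : ¬ (p : ℤ) ∣ x ^ 2 := fun h => hu ((dvd_sub_left h).1 hd)
  refine isSquare_intCast_of_dvd_sub_sq 1 ?_ (by rwa [pow_one])
  rw [pow_one]
  exact not_dvd_mul (not_dvd_four hp₂) hx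

theorem isNormFrom_of_not_dvd (hp₂ : p ≠ 2) {u v : ℤ} (hu : ¬ (p : ℤ) ∣ u)
    (hv : ¬ (p : ℤ) ∣ v) : IsNormFrom (u : ℚ_[p]) (v : ℚ_[p]) := by
  have hu' : (u : ZMod p) ≠ 0 := by rwa [Ne, ZMod.intCast_zmod_eq_zero_iff_dvd]
  obtain ⟨x, y, hxy⟩ := FiniteField.exists_root_sum_quadratic (R := ZMod p)
    (f := .X ^ 2 - .C (v : ZMod p)) (g := .C (-(u : ZMod p)) * .X ^ 2)
    (Polynomial.degree_X_pow_sub_C (by norm_num) _)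
    (Polynomial.degree_C_mul_X_pow 2 (neg_ne_zero.2 hu'))
    (by rw [ZMod.card]; exact Nat.odd_iff.1 (hp.out.odd_of_ne_two hp₂))
  obtain ⟨x, rfl⟩ := ZMod.intCast_surjective x
  obtain ⟨y, rfl⟩ := ZMod.intCast_surjective y
  refine isNormFrom_of_dvd_sub 1 (x := x) (y := y) ?_ ?_ <;> rw [pow_one]
  · exact not_dvd_mul (not_dvd_four hp₂) hv
  · simp only [Polynomial.eval_sub, Polynomial.eval_pow, Polynomial.eval_X, Polynomial.eval_C,
      Polynomial.eval_mul] at hxy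
    rw [← ZMod.intCast_zmod_eq_zero_iff_dvd]
    push_cast
    linear_combination hxy

theorem jacobiSym_eq_one_of_isNormFrom {u v : ℤ} (hu : ¬ (p : ℤ) ∣ u) (hv : ¬ (p : ℤ) ∣ v)
    (h : IsNormFrom (u : ℚ_[p]) ((p * v : ℤ) : ℚ_[p])) : J(u | p) = 1 := by
  refine (jacobiSym_eq_one_or_neg_one hu).resolve_right fun hJ => ?_
  obtain ⟨X, Y, Z, h, hone⟩ := exists_primitive_of_isNormFrom h
  have toZMod_eq_zero (T : ℤ_[p]) : PadicInt.toZMod T = 0 ↔ (p : ℤ_[p]) ∣ T := by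
    rw [← RingHom.mem_ker, PadicInt.ker_toZMod, PadicInt.maximalIdeal_eq_span_p,
      Ideal.mem_span_singleton]
  have hmod : PadicInt.toZMod X ^ 2 = u * PadicInt.toZMod Y ^ 2 := by
    simpa [sub_eq_zero] using congrArg PadicInt.toZMod h
  have hY : PadicInt.toZMod Y = 0 := by
    by_contra hY
    exact ZMod.nonsquare_of_jacobiSym_eq_neg_one hJ ⟨PadicInt.toZMod X / PadicInt.toZMod Y, by
      rw [div_mul_div_comm, ← sq, ← sq, hmod, mul_div_cancel_right₀ _ (pow_ne_zero 2 hY)]⟩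
  have hX : PadicInt.toZMod X = 0 := by simpa [hY] using hmod
  have hZ : PadicInt.toZMod Z = 0 := by
    obtain ⟨X', rfl⟩ := (toZMod_eq_zero X).1 hX
    obtain ⟨Y', rfl⟩ := (toZMod_eq_zero Y).1 hY
    have hp₀ : (p : ℤ_[p]) ≠ 0 := by exact_mod_cast hp.out.ne_zero
    have h' : (p : ℤ_[p]) * (X' ^ 2 - u * Y' ^ 2) = v * Z ^ 2 := by
      push_cast at h
      exact mul_left_cancel₀ hp₀ (by linear_combination h)
    have hv' : (v : ZMod p) ≠ 0 := by rwa [Ne, ZMod.intCast_zmod_eq_zero_iff_dvd]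
    simpa [hv'] using (congrArg PadicInt.toZMod h').symm
  rcases hone with rfl | rfl | rfl
  · simp at hX
  · simp at hY
  · simp at hZ

theorem symbolDetects_tameSymbol (hp₂ : p ≠ 2) {a b : ℤ} (ha : a ≠ 0) (hb : b ≠ 0) :
    SymbolDetects ℚ_[p] (tameSymbol p) a b := by
  refine .of_units (p := p) (isSymbol_tameSymbol p) ha hb (fun u v hu hv => ?_)
    fun u v hu hv => ?_
  · exact iff_of_true (isNormFrom_of_not_dvd hp₂ hu hv) (tameSymbol_of_not_dvd hu hv)
  · have hsymbol : tameSymbol p u (p * v) = J(u | p) := by simpa using tameSymbol_pow_mul hu hv 0 1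
    have hu₀ : (u : ℚ_[p]) ≠ 0 := by exact_mod_cast ne_zero_of_not_dvd hu
    rw [SymbolDetects, hsymbol]
    exact ⟨jacobiSym_eq_one_of_isNormFrom hu hv,
      fun h => .of_isSquare hu₀ (isSquare_of_jacobiSym_eq_one hp₂ hu h) _⟩

theorem four_mul_intCast {u : ℤ} (hu : ¬ 2 ∣ u) : 4 * (u : ZMod 8) = 4 := by
  exact_mod_cast (intCast_eq_intCast_iff_dvd_sub (4 * u) 4 8).2 (by lia)

theorem eight_mul_intCast {u : ℤ} (hu : ¬ 2 ∣ u) : 8 * (u : ZMod 16) = 8 := by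
  exact_mod_cast (intCast_eq_intCast_iff_dvd_sub (8 * u) 8 16).2 (by lia)

theorem exists_sq_sub_mul_sq_eq_of_χ₄ : ∀ U V : ZMod 8, 4 * U = 4 → 4 * V = 4 →
    (if χ₄ (cast U : ZMod 4) = -1 then χ₄ (cast V : ZMod 4) else 1) = 1 →
      ∃ X Y : ZMod 8, X ^ 2 - U * Y ^ 2 = V := by
  decide

theorem χ₄_eq_one_of_sq_sub_mul_sq_eq : ∀ U V : ZMod 8, 4 * U = 4 → 4 * V = 4 →
    ∀ X Y Z : ZMod 8, X ^ 2 - U * Y ^ 2 = V * Z ^ 2 → (X = 1 ∨ Y = 1 ∨ Z = 1) →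
      (if χ₄ (cast U : ZMod 4) = -1 then χ₄ (cast V : ZMod 4) else 1) = 1 := by
  decide

theorem exists_sq_sub_mul_sq_eq_two_mul_of_χ₄_mul_χ₈ :
    ∀ U V : ZMod 16, 8 * U = 8 → 8 * V = 8 →
      (if χ₄ (cast U : ZMod 4) = -1 then χ₄ (cast V : ZMod 4) else 1) * χ₈ (cast U : ZMod 8) = 1 →
        2 * U = 2 ∨ ∃ X Y : ZMod 16, X ^ 2 - U * Y ^ 2 = 2 * V := by
  decide

theorem χ₄_mul_χ₈_eq_one_of_sq_sub_mul_sq_eq : ∀ U V : ZMod 8, 4 * U = 4 → 4 * V = 4 →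
    ∀ X Y Z : ZMod 8, X ^ 2 - U * Y ^ 2 = 2 * V * Z ^ 2 → (X = 1 ∨ Y = 1 ∨ Z = 1) →
      (if χ₄ (cast U : ZMod 4) = -1 then χ₄ (cast V : ZMod 4) else 1) * χ₈ U = 1 := by
  decide

theorem symbolDetects_dyadicSymbol_of_not_dvd {u v : ℤ} (hu : ¬ 2 ∣ u) (hv : ¬ 2 ∣ v) :
    SymbolDetects ℚ_[2] dyadicSymbol u v := by
  have cast_four (w : ℤ) : (w : ZMod 4) = cast (w : ZMod 8) := (cast_intCast (by norm_num) w).symm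
  have hU := four_mul_intCast hu
  have hV := four_mul_intCast hv
  rw [SymbolDetects, dyadicSymbol_of_not_dvd hu hv, cast_four, cast_four]
  constructor
  · intro h
    obtain ⟨X, Y, Z, h, hone⟩ := exists_primitive_of_isNormFrom h
    refine χ₄_eq_one_of_sq_sub_mul_sq_eq _ _ hU hV (PadicInt.toZModPow 3 X)
      (PadicInt.toZModPow 3 Y) (PadicInt.toZModPow 3 Z) ?_ ?_
    · simpa using congrArg (PadicInt.toZModPow (p := 2) 3) h
    · rcases hone with rfl | rfl | rfl <;> simp
  · intro h
    obtain ⟨x, y, hxy⟩ := exists_sq_sub_mul_sq_eq_of_χ₄ _ _ hU hV h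
    obtain ⟨x, rfl⟩ := intCast_surjective x
    obtain ⟨y, rfl⟩ := intCast_surjective y
    refine isNormFrom_of_dvd_sub (p := 2) (x := x) (y := y) 3 ?_ ?_
    · norm_num
      lia
    · exact (intCast_zmod_eq_zero_iff_dvd _ 8).1 (by push_cast; rw [hxy, sub_self])

theorem symbolDetects_dyadicSymbol_two_mul {u v : ℤ} (hu : ¬ 2 ∣ u) (hv : ¬ 2 ∣ v) :
    SymbolDetects ℚ_[2] dyadicSymbol u (2 * v) := by
  have cast_four (w : ℤ) : (w : ZMod 4) = cast (w : ZMod 8) := (cast_intCast (by norm_num) w).symm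
  have cast_four' (w : ℤ) : (w : ZMod 4) = cast (w : ZMod 16) :=
    (cast_intCast (by norm_num) w).symm
  have cast_eight (w : ℤ) : (w : ZMod 8) = cast (w : ZMod 16) := (cast_intCast (by norm_num) w).symm
  have hsymbol : dyadicSymbol u (2 * v) = (if χ₄ u = -1 then χ₄ v else 1) * χ₈ u := by
    simpa using dyadicSymbol_pow_mul hu hv 0 1
  rw [SymbolDetects, hsymbol]
  constructor
  · intro h
    obtain ⟨X, Y, Z, h, hone⟩ := exists_primitive_of_isNormFrom h
    rw [cast_four, cast_four]
    refine χ₄_mul_χ₈_eq_one_of_sq_sub_mul_sq_eq _ _ (four_mul_intCast hu) (four_mul_intCast hv)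
      (PadicInt.toZModPow 3 X) (PadicInt.toZModPow 3 Y) (PadicInt.toZModPow 3 Z) ?_ ?_
    · simpa [map_ofNat] using congrArg (PadicInt.toZModPow (p := 2) 3) h
    · rcases hone with rfl | rfl | rfl <;> simp
  · intro h
    rw [cast_four', cast_four', cast_eight] at h
    rcases exists_sq_sub_mul_sq_eq_two_mul_of_χ₄_mul_χ₈ _ _ (eight_mul_intCast hu)
      (eight_mul_intCast hv) h with hU | ⟨x, y, hxy⟩
    · have hd : (16 : ℤ) ∣ 2 * u - 2 :=
        (intCast_zmod_eq_zero_iff_dvd _ 16).1 (by push_cast; rw [hU, sub_self])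
      have hu₀ : (u : ℚ_[2]) ≠ 0 := by exact_mod_cast ne_zero_of_not_dvd hu
      refine .of_isSquare hu₀ (isSquare_intCast_of_dvd_sub_sq (x := 1) 3 (by norm_num) ?_) _
      norm_num
      lia
    · obtain ⟨x, rfl⟩ := intCast_surjective x
      obtain ⟨y, rfl⟩ := intCast_surjective y
      refine isNormFrom_of_dvd_sub (p := 2) (x := x) (y := y) 4 ?_ ?_
      · norm_num
        lia
      · exact (intCast_zmod_eq_zero_iff_dvd _ 16).1 (by push_cast; rw [hxy, sub_self])

theorem symbolDetects_dyadicSymbol {a b : ℤ} (ha : a ≠ 0) (hb : b ≠ 0) :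
    SymbolDetects ℚ_[2] dyadicSymbol a b :=
  .of_units (p := 2) isSymbol_dyadicSymbol ha hb
    (fun _ _ => symbolDetects_dyadicSymbol_of_not_dvd)
    fun _ _ => symbolDetects_dyadicSymbol_two_mul

end Padic

theorem symbolDetects_realSymbol {a b : ℤ} (ha : a ≠ 0) (hb : b ≠ 0) :
    SymbolDetects ℝ realSymbol a b := by
  have isNormFrom_of_pos {a : ℤ} (ha : 0 < a) (b : ℝ) : IsNormFrom (a : ℝ) b :=
    .of_isSquare (by exact_mod_cast ha.ne') (Real.isSquare_iff.2 (by exact_mod_cast ha.le)) b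
  unfold SymbolDetects realSymbol
  constructor
  · rintro ⟨x, y, h⟩
    refine if_neg fun ⟨ha', hb'⟩ => ?_
    rify at ha' hb'
    nlinarith [sq_nonneg x, mul_nonneg (neg_nonneg.2 ha'.le) (sq_nonneg y)]
  · intro h
    rcases ha.lt_or_gt with ha' | ha'
    · have hb' : 0 < b := hb.lt_or_gt.resolve_left fun hb' => by simp [ha', hb'] at h
      exact (isNormFrom_of_pos hb' _).symm (by exact_mod_cast ha)
    · exact isNormFrom_of_pos ha' _

theorem splitsAt_iff_hilbertSymbol_eq_one {a b : ℤ} (ha : a ≠ 0) (hb : b ≠ 0) (v : RatPlace) :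
    SplitsAt a b v ↔ hilbertSymbol v a b = 1 := by
  have ha' : (a : ℚ) ≠ 0 := by exact_mod_cast ha
  have hb' : (b : ℚ) ≠ 0 := by exact_mod_cast hb
  rcases v with _ | p
  · refine (splitsOver_iff_isNormFrom ℝ ha' hb').trans ?_
    rw [Rat.cast_intCast, Rat.cast_intCast]
    exact symbolDetects_realSymbol ha hb
  · refine (splitsOver_iff_isNormFrom ℚ_[p] ha' hb').trans ?_
    rw [Rat.cast_intCast, Rat.cast_intCast]
    obtain rfl | hp := eq_or_ne p primeTwo
    · rw [hilbertSymbol_two]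
      exact symbolDetects_dyadicSymbol ha hb
    · rw [hilbertSymbol_odd hp]
      exact symbolDetects_tameSymbol (coe_ne_two hp) ha hb

section LegendreDescent

theorem isSquare_intCast_zmod_of_squarefree {a : ℤ} {n : ℕ} (hn : Squarefree n)
    (h : ∀ p : ℕ, p.Prime → p ∣ n → IsSquare (a : ZMod p)) : IsSquare (a : ZMod n) := by
  induction n using induction_on_primes with
  | zero => simp at hn
  | one => exact ⟨0, Subsingleton.elim (α := ZMod 1) _ _⟩
  | prime_mul p n hp ih =>
    obtain ⟨x, hx⟩ := h p hp (dvd_mul_right p n)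
    obtain ⟨y, hy⟩ := ih hn.of_mul_right fun q hq hqn => h q hq (hqn.mul_left p)
    have hxy : IsSquare (a : ZMod p × ZMod n) := ⟨(x, y), Prod.ext (by simpa) (by simpa)⟩
    simpa using hxy.map (ZMod.chineseRemainder (Nat.coprime_of_squarefree_mul hn)).symm

theorem exists_sq_sub_eq_mul_of_isSquare {a b : ℤ} (hb : b ≠ 0)
    (h : IsSquare (a : ZMod b.natAbs)) :
    ∃ s c : ℤ, s ^ 2 - a = b * c ∧ 2 * s.natAbs ≤ b.natAbs := by
  have : NeZero b.natAbs := ⟨Int.natAbs_ne_zero.2 hb⟩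
  obtain ⟨t, ht⟩ := h
  have hdvd : b ∣ t.valMinAbs ^ 2 - a := by
    rw [← Int.natAbs_dvd, ← ZMod.intCast_zmod_eq_zero_iff_dvd]
    push_cast
    rw [ht, sq, sub_self]
  obtain ⟨c, hc⟩ := hdvd
  have hle := ZMod.natAbs_valMinAbs_le t
  exact ⟨t.valMinAbs, c, hc, by lia⟩

theorem natAbs_lt_of_sq_sub_eq_mul {a b c s : ℤ} (hab : a.natAbs ≤ b.natAbs)
    (hb : 2 ≤ b.natAbs) (hs : 2 * s.natAbs ≤ b.natAbs) (h : s ^ 2 - a = b * c) :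
    c.natAbs < b.natAbs := by
  have hbc : b.natAbs * c.natAbs ≤ s.natAbs ^ 2 + a.natAbs := by
    rw [← Int.natAbs_mul, ← h, ← Int.natAbs_pow]
    exact Int.natAbs_sub_le _ _
  have hs₂ : (2 * s.natAbs) ^ 2 ≤ b.natAbs ^ 2 := Nat.pow_le_pow_left hs 2
  by_contra! hcb
  have hbb : b.natAbs * b.natAbs ≤ b.natAbs * c.natAbs := Nat.mul_le_mul_left _ hcb
  nlinarith

theorem exists_eq_mul_sq_of_not_squarefree {b : ℤ} (hb : b ≠ 0) (h : ¬ Squarefree b) :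
    ∃ c r : ℤ, b = c * r ^ 2 ∧ c.natAbs < b.natAbs := by
  obtain ⟨r, ⟨c, rfl⟩, hr⟩ : ∃ r, r * r ∣ b ∧ ¬ IsUnit r := by simpa [Squarefree] using h
  refine ⟨c, r, by ring, ?_⟩
  have hc : 0 < c.natAbs := Int.natAbs_pos.2 (right_ne_zero_of_mul hb)
  have hr₀ : 0 < r.natAbs := Int.natAbs_pos.2 (left_ne_zero_of_mul (left_ne_zero_of_mul hb))
  have hr₁ : r.natAbs ≠ 1 := fun h => hr (Int.isUnit_iff_natAbs_eq.2 h)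
  rw [Int.natAbs_mul, Int.natAbs_mul]
  exact (Nat.lt_mul_iff_one_lt_left hc).2 (Nat.one_lt_mul_iff.2 ⟨hr₀, hr₀, by lia⟩)

theorem hilbertSymbol_eq_one_of_isNormFrom {a b : ℤ} (ha : a ≠ 0) (hb : b ≠ 0)
    (h : IsNormFrom (a : ℚ) (b : ℚ)) (v : RatPlace) : hilbertSymbol v a b = 1 := by
  have ha' : (a : ℚ) ≠ 0 := by exact_mod_cast ha
  have hb' : (b : ℚ) ≠ 0 := by exact_mod_cast hb
  rw [← splitsAt_iff_hilbertSymbol_eq_one ha hb]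
  rcases v with _ | p
  · exact (splitsOver_iff_isNormFrom ℝ ha' hb').2 (h.map (Rat.castHom ℝ))
  · exact (splitsOver_iff_isNormFrom ℚ_[p] ha' hb').2 (h.map (Rat.castHom ℚ_[p]))

theorem isSquare_intCast_zmod_of_hilbertSymbol {p : Nat.Primes} {a b : ℤ} (hb : Squarefree b)
    (hpb : (p : ℤ) ∣ b) (h : hilbertSymbol (.finite p) a b = 1) : IsSquare (a : ZMod p) := by
  obtain rfl | hp := eq_or_ne p primeTwo
  · exact FiniteField.isSquare_of_char_two (F := ZMod 2) (ZMod.ringChar_zmod_n 2) _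
  by_cases hpa : (p : ℤ) ∣ a
  · exact ⟨0, by simpa using (ZMod.intCast_zmod_eq_zero_iff_dvd a p).2 hpa⟩
  obtain ⟨c, rfl⟩ := hpb
  have hc : ¬ (p : ℤ) ∣ c := fun hc =>
    (Nat.prime_iff_prime_int.1 p.2).not_isUnit (hb p (mul_dvd_mul_left (p : ℤ) hc))
  have hsymbol : tameSymbol p a (p * c) = jacobiSym a p := by
    simpa using tameSymbol_pow_mul hpa hc 0 1
  rw [hilbertSymbol_odd hp, hsymbol] at h
  exact ZMod.isSquare_of_jacobiSym_eq_one h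

theorem isNormFrom_of_natAbs_eq_one {a b : ℤ} (ha : a.natAbs = 1) (hb : b.natAbs = 1)
    (h : hilbertSymbol .infinite a b = 1) : IsNormFrom (a : ℚ) (b : ℚ) := by
  rcases Int.natAbs_eq_iff.1 hb with rfl | rfl
  · simpa using IsNormFrom.one_right (a : ℚ)
  · rcases Int.natAbs_eq_iff.1 ha with rfl | rfl
    · exact .of_isSquare (by simp) (by simp) _
    · simp [hilbertSymbol, realSymbol] at h

theorem isSquare_or_exists_natAbs_lt_isNormFrom_mul {a b : ℤ} (hab : a.natAbs ≤ b.natAbs)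
    (hb : 2 ≤ b.natAbs) (h : ∀ v, hilbertSymbol v a b = 1) :
    IsSquare (a : ℚ) ∨ ∃ c : ℤ, c ≠ 0 ∧ c.natAbs < b.natAbs ∧ IsNormFrom (a : ℚ) (b * c) := by
  have hb₀ : b ≠ 0 := by
    rintro rfl
    simp at hb
  by_cases hsf : Squarefree b
  · obtain ⟨s, c, hc, hs⟩ := exists_sq_sub_eq_mul_of_isSquare (a := a) hb₀ <|
      isSquare_intCast_zmod_of_squarefree (Int.squarefree_natAbs.2 hsf) fun p hp hpb =>
        isSquare_intCast_zmod_of_hilbertSymbol (p := ⟨p, hp⟩) hsf (Int.natCast_dvd.2 hpb) (h _)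
    have hcQ : (s : ℚ) ^ 2 - a = b * c := by exact_mod_cast hc
    obtain rfl | hc₀ := eq_or_ne c 0
    · exact .inl ⟨s, by linear_combination -hcQ⟩
    · exact .inr ⟨c, hc₀, natAbs_lt_of_sq_sub_eq_mul hab hb hs hc, s, 1, by
        linear_combination hcQ⟩
  · obtain ⟨c, r, rfl, hc⟩ := exists_eq_mul_sq_of_not_squarefree hb₀ hsf
    refine .inr ⟨c, left_ne_zero_of_mul hb₀, hc, ?_⟩
    convert IsNormFrom.sq (a : ℚ) (c * r) using 1
    push_cast
    ring

/-- Legendre's descent: a representation `s ^ 2 - a = b * c` with `|c| < |b|` replaces `b` by `c`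
without changing the classes at stake. -/
theorem isNormFrom_of_hilbertSymbol_eq_one {a b : ℤ} (ha : a ≠ 0) (hb : b ≠ 0)
    (h : ∀ v, hilbertSymbol v a b = 1) : IsNormFrom (a : ℚ) (b : ℚ) := by
  induction hN : a.natAbs + b.natAbs using Nat.strong_induction_on generalizing a b with
  | _ N ih =>
  subst hN
  have haQ : (a : ℚ) ≠ 0 := by exact_mod_cast ha
  have hbQ : (b : ℚ) ≠ 0 := by exact_mod_cast hb
  wlog hab : a.natAbs ≤ b.natAbs generalizing a b
  · refine (this hb ha (fun v => ?_) (fun M hM c d hc hd hcd e => ?_) hbQ haQ (by lia)).symm haQ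
    · rw [(isSymbol_hilbertSymbol v).comm hb ha, h]
    · exact ih M (by lia) hc hd hcd e
  rcases lt_or_ge b.natAbs 2 with hb₂ | hb₂
  · have ha_pos := Int.natAbs_pos.2 ha
    exact isNormFrom_of_natAbs_eq_one (by lia) (by lia) (h _)
  rcases isSquare_or_exists_natAbs_lt_isNormFrom_mul hab hb₂ h with hsq | ⟨c, hc, hcb, hbc⟩
  · exact .of_isSquare haQ hsq _
  · have hac : IsNormFrom (a : ℚ) c := by
      refine ih _ (by lia) ha hc (fun v => ?_) rfl
      have hv := hilbertSymbol_eq_one_of_isNormFrom ha (mul_ne_zero hb hc) (by exact_mod_cast hbc) v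
      rwa [(isSymbol_hilbertSymbol v).mul_right ha hb hc, h v, one_mul] at hv
    exact (hac.mul_right_iff (by exact_mod_cast hc)).1 (by rwa [mul_comm])

end LegendreDescent

section CommonSlot

theorem exists_forall_modEq (s : Finset Nat.Primes) (e : Nat.Primes → ℕ) (r : Nat.Primes → ℤ) :
    ∃ N : ℤ, ∀ p ∈ s, N ≡ r p [ZMOD (p : ℤ) ^ e p] := by
  obtain ⟨N, hN⟩ := IsDedekindDomain.exists_forall_sub_mem_ideal (s := s)
    (fun p : Nat.Primes => Ideal.span {(p : ℤ)}) e
    (fun p _ => (Ideal.prime_span_singleton_iff).2 (Nat.prime_iff_prime_int.1 p.2))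
    (fun p _ q _ hpq h => prime_not_dvd_prime hpq
      (Ideal.span_singleton_le_span_singleton.1 h.ge)) fun p => r p
  refine ⟨N, fun p hp => (Int.modEq_iff_dvd.2 ?_).symm⟩
  simpa only [Ideal.span_singleton_pow, Ideal.mem_span_singleton] using hN p hp

theorem exists_prime_gcd_mul_modEq (N : ℤ) {M : ℕ} (hM : M ≠ 0) :
    ∃ q : Nat.Primes, (Int.gcd N M : ℤ) * q ≡ N [ZMOD M] := by
  have hgcd : 0 < Int.gcd N M := Int.gcd_pos_of_ne_zero_right _ (by exact_mod_cast hM)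
  have hgM : Int.gcd N M ∣ M := by exact_mod_cast Int.gcd_dvd_right N (M : ℤ)
  have hcop := Int.isCoprime_iff_gcd_eq_one.2 (Int.gcd_ediv_gcd_ediv_gcd hgcd)
  rw [← Int.natCast_div] at hcop
  obtain ⟨q, -, hq, hmod⟩ := Nat.forall_exists_prime_gt_and_zmodEq 0
    (Nat.div_pos (Nat.le_of_dvd (Nat.pos_of_ne_zero hM) hgM) hgcd).ne' hcop
  have hmul := hmod.mul_left' (c := (Int.gcd N M : ℤ))
  rw [Int.mul_ediv_cancel' (Int.gcd_dvd_left ..), ← Int.natCast_mul,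
    Nat.mul_div_cancel' hgM] at hmul
  exact ⟨⟨q, hq⟩, hmul⟩

theorem exists_mem_of_dvd_prod_pow {s : Finset Nat.Primes} {e : Nat.Primes → ℕ} {p : Nat.Primes}
    (h : (p : ℕ) ∣ ∏ q ∈ s, (q : ℕ) ^ e q) : p ∈ s := by
  obtain ⟨q, hq, hpq⟩ := (p.2.prime.dvd_finsetProd_iff _).1 h
  rwa [Subtype.ext ((Nat.prime_dvd_prime_iff_eq p.2 q.2).1 (p.2.dvd_of_dvd_pow hpq))]

theorem exists_modEq_and_not_dvd (s : Finset Nat.Primes) (e : Nat.Primes → ℕ)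
    (r : Nat.Primes → ℤ) {m : ℤ} (hm : m ≠ 0) :
    ∃ (n : ℤ) (q : Nat.Primes), n ≠ 0 ∧ (n < 0 ↔ m < 0) ∧
      (∀ p ∈ s, n ≡ r p [ZMOD (p : ℤ) ^ e p]) ∧ ∀ p ∉ s, p ≠ q → ¬ (p : ℤ) ∣ n := by
  obtain ⟨N, hN⟩ := exists_forall_modEq s e r
  set M : ℕ := ∏ p ∈ s, (p : ℕ) ^ e p
  have hM₀ : M ≠ 0 := Finset.prod_ne_zero_iff.2 fun p _ => pow_ne_zero _ p.2.ne_zero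
  obtain ⟨q, hq⟩ := exists_prime_gcd_mul_modEq (m.sign * N) hM₀
  set g : ℕ := Int.gcd (m.sign * N) M
  have hg : g ≠ 0 := (Int.gcd_pos_of_ne_zero_right _ (by exact_mod_cast hM₀)).ne'
  have hgq : (0 : ℤ) < g * q := by exact_mod_cast Nat.mul_pos (Nat.pos_of_ne_zero hg) q.2.pos
  have hsign : m.sign * m.sign = 1 := by
    rw [← Int.sign_mul, Int.sign_eq_one_of_pos (mul_self_pos.2 hm)]
  refine ⟨m.sign * (g * q), q, by simp [hm, hg, q.2.ne_zero], ?_, fun p hp => ?_, ?_⟩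
  · simp [mul_neg_iff, hgq, hgq.not_gt]
  · have hpM : (p : ℤ) ^ e p ∣ M := by exact_mod_cast Finset.dvd_prod_of_mem _ hp
    have hn := (hq.mul_left m.sign).of_dvd hpM
    rw [← mul_assoc m.sign m.sign N, hsign, one_mul] at hn
    exact hn.trans (hN p hp)
  · intro p hps hpq hd
    have hd := hd.mul_left m.sign
    rw [← mul_assoc, hsign, one_mul] at hd
    rcases (Nat.prime_iff_prime_int.1 p.2).dvd_or_dvd hd with hpg | hpq'
    · have hpM : (p : ℤ) ∣ M := hpg.trans (Int.gcd_dvd_right ..)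
      exact hps (exists_mem_of_dvd_prod_pow (by exact_mod_cast hpM))
    · exact prime_not_dvd_prime hpq hpq'

theorem realSymbol_congr {m n : ℤ} (h : n < 0 ↔ m < 0) (b : ℤ) :
    realSymbol n b = realSymbol m b := by
  simp only [realSymbol, h]

/-- The local solutions are matched by one integer up to a single auxiliary prime, which the
product formula takes care of. -/
theorem exists_global_common_slot {a b c : ℤ} (ha : a ≠ 0) (hb : b ≠ 0) (hc : c ≠ 0)
    (h : ∀ v, hilbertSymbol v a b = 1 ∨ ∃ m ≠ 0, hilbertSymbol v m c = -1) :
    ∃ n ≠ 0, ∀ v, hilbertSymbol v a (-(n * b)) = 1 ∧ hilbertSymbol v (a * c) (n * a) = 1 := by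
  choose r hr₀ hra hrac using fun v =>
    (isSymbol_hilbertSymbol v).exists_common_slot ha hb hc (h v)
  obtain ⟨s, hs⟩ := exists_finset_primes_dvd (a := 2 * a * b * c) (by simp [ha, hb, hc])
  obtain ⟨n, q, hn, hsign, hmod, hdvd⟩ := exists_modEq_and_not_dvd s
    (fun p => padicValInt p (r (.finite p)) + 3) (fun p => r (.finite p)) (hr₀ .infinite)
  have hnb : -(n * b) ≠ 0 := neg_ne_zero.2 (mul_ne_zero hn hb)
  have hna := mul_ne_zero hn ha
  have hac := mul_ne_zero ha hc
  have of_congr (v : RatPlace) (hv : ∀ d, hilbertSymbol v n d = hilbertSymbol v (r v) d) :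
      hilbertSymbol v a (-(n * b)) = 1 ∧ hilbertSymbol v (a * c) (n * a) = 1 :=
    (isSymbol_hilbertSymbol v).eq_one_of_common_slot ha hb hc hn ((hv a).trans (hra v))
      ((hv _).trans (hrac v))
  have away (v : RatPlace) (hv : v ≠ .finite q) :
      hilbertSymbol v a (-(n * b)) = 1 ∧ hilbertSymbol v (a * c) (n * a) = 1 := by
    rcases v with _ | p
    · exact of_congr _ (realSymbol_congr hsign)
    by_cases hp : p ∈ s
    · exact of_congr _ (hilbertSymbol_finite_congr (hr₀ _) (hmod p hp))
    · have hpn := hdvd p hp fun h => hv (congrArg _ h)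
      have hpD := (hs p).not.1 hp
      simp only [(Nat.prime_iff_prime_int.1 p.2).dvd_mul, not_or] at hpD
      obtain ⟨⟨⟨hp₂, hpa⟩, hpb⟩, hpc⟩ := hpD
      have hp₂' : (p : ℕ) ≠ 2 := fun h => hp₂ (by rw [h]; rfl)
      exact ⟨hilbertSymbol_of_not_dvd hp₂' hpa (by rw [Int.dvd_neg]; exact not_dvd_mul hpn hpb),
        hilbertSymbol_of_not_dvd hp₂' (not_dvd_mul hpa hpc) (not_dvd_mul hpn hpa)⟩
  refine ⟨n, hn, fun v => ?_⟩
  obtain rfl | hv := eq_or_ne v (.finite q)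
  · exact ⟨hilbertSymbol_eq_one_of_forall_ne ha hnb fun v hv => (away v hv).1,
      hilbertSymbol_eq_one_of_forall_ne hac hna fun v hv => (away v hv).2⟩
  · exact away v hv

theorem exists_pure_sq_eq_of_hilbertSymbol {a b c : ℤ} (ha : a ≠ 0) (hb : b ≠ 0) (hc : c ≠ 0)
    (h : ∀ v, hilbertSymbol v a b = 1 ∨ ∃ m ≠ 0, hilbertSymbol v m c = -1) :
    ∃ x y z : ℚ, a * x ^ 2 + b * y ^ 2 - a * b * z ^ 2 = c := by
  obtain ⟨n, hn, hslot⟩ := exists_global_common_slot ha hb hc h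
  have h₁ := isNormFrom_of_hilbertSymbol_eq_one ha (neg_ne_zero.2 (mul_ne_zero hn hb))
    fun v => (hslot v).1
  have h₂ := isNormFrom_of_hilbertSymbol_eq_one (mul_ne_zero ha hc) (mul_ne_zero hn ha)
    fun v => (hslot v).2
  push_cast at h₁ h₂
  exact IsNormFrom.exists_pure_sq_eq_of_common_slot (by exact_mod_cast ha) (by exact_mod_cast hb)
    (by exact_mod_cast hn) h₁ h₂

end CommonSlot

section SymbolNonsquare

open ZMod
open scoped NumberTheorySymbols

/-- The nonzero integer `c` is detected by the Hilbert symbol not to be a square in the completion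
of `ℚ` at `v`. -/
def IsSymbolNonsquare (v : RatPlace) (c : ℤ) : Prop := c ≠ 0 ∧ ∃ m ≠ 0, hilbertSymbol v m c = -1

namespace IsSymbolNonsquare

theorem infinite_of_neg {c : ℤ} (hc : c < 0) : IsSymbolNonsquare .infinite c :=
  ⟨hc.ne, -1, by decide, by simp [hilbertSymbol, realSymbol, hc]⟩

theorem congr {p : Nat.Primes} {c c' : ℤ} (hc : IsSymbolNonsquare (.finite p) c)
    (h : c' ≡ c [ZMOD (p : ℤ) ^ (padicValInt p c + 3)]) : IsSymbolNonsquare (.finite p) c' := by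
  obtain ⟨hc₀, m, hm, hmc⟩ := hc
  have hc' : c' ≠ 0 := by
    rintro rfl
    have := ((padicValInt_dvd_iff _ _).1 (Int.modEq_zero_iff_dvd.1 h.symm)).resolve_left hc₀
    lia
  have hcomm {d : ℤ} (hd : d ≠ 0) := (isSymbol_hilbertSymbol (.finite p)).comm hm hd
  exact ⟨hc', m, hm, by rw [hcomm hc', hilbertSymbol_finite_congr hc₀ h, ← hcomm hc₀, hmc]⟩

theorem of_jacobiSym {p : Nat.Primes} (hp₂ : (p : ℕ) ≠ 2) {c : ℤ} (h : J(c | p) = -1) :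
    IsSymbolNonsquare (.finite p) c := by
  have hpc : ¬ (p : ℤ) ∣ c := fun hd => by
    rw [jacobiSym.mod_left' (Int.modEq_zero_iff_dvd.2 hd), jacobiSym.zero_left p.2.one_lt] at h
    norm_num at h
  have hc₀ := ne_zero_of_not_dvd hpc
  have hp₀ : (p : ℤ) ≠ 0 := by exact_mod_cast p.2.ne_zero
  refine ⟨hc₀, p, hp₀, ?_⟩
  rw [(isSymbol_hilbertSymbol _).comm hp₀ hc₀, hilbertSymbol, if_neg hp₂,
    tameSymbol_prime_right hpc, h]

theorem prime_mul {p : Nat.Primes} (hp₂ : (p : ℕ) ≠ 2) {w : ℤ} (hw : ¬ (p : ℤ) ∣ w) :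
    IsSymbolNonsquare (.finite p) (p * w) := by
  obtain ⟨m, hm⟩ := FiniteField.exists_nonsquare (F := ZMod p) (by rwa [ringChar_zmod_n])
  obtain ⟨m, rfl⟩ := intCast_surjective m
  have hpm : ¬ (p : ℤ) ∣ m := fun hd =>
    hm ((intCast_zmod_eq_zero_iff_dvd m p).2 hd ▸ IsSquare.zero)
  have hp₀ : (p : ℤ) ≠ 0 := by exact_mod_cast p.2.ne_zero
  refine ⟨mul_ne_zero hp₀ (ne_zero_of_not_dvd hw), m, ne_zero_of_not_dvd hpm, ?_⟩
  rw [hilbertSymbol, if_neg hp₂, ← nonsquare_iff_jacobiSym_eq_neg_one.2 hm]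
  simpa using tameSymbol_pow_mul hpm hw 0 1

theorem of_mod_eight {c : ℤ} (h : c ≡ 5 [ZMOD 8]) : IsSymbolNonsquare (.finite primeTwo) c := by
  have hc : c % 8 = 5 := h
  refine ⟨by lia, 2, by decide, ?_⟩
  rw [hilbertSymbol_two, dyadicSymbol_two_left (by lia), χ₈_int_mod_eight, hc]
  rfl

theorem of_mod_sixteen {c : ℤ} (h : c ≡ 12 [ZMOD 16]) :
    IsSymbolNonsquare (.finite primeTwo) c := by
  have hc : c % 16 = 12 := h
  obtain ⟨w, rfl⟩ : ∃ w, c = 2 ^ 2 * w := ⟨c / 4, by lia⟩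
  refine ⟨by lia, -1, by decide, ?_⟩
  have hsymbol := dyadicSymbol_pow_mul (u := -1) (v := w) (by decide) (by lia) 0 2
  have h₄ : χ₄ ((-1 : ℤ) : ZMod 4) = -1 := by decide
  have h₈ : χ₈ ((-1 : ℤ) : ZMod 8) = 1 := by decide
  rw [if_pos h₄, h₈, χ₄_int_three_mod_four (by lia)] at hsymbol
  simpa [hilbertSymbol_two] using hsymbol

end IsSymbolNonsquare

end SymbolNonsquare

section FiniteFieldTrace

theorem exists_add_eq_of_card_lt_two_mul_card {G : Type*} [AddGroup G] [Fintype G] {A : Finset G}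
    (hA : Fintype.card G < 2 * A.card) (t : G) : ∃ x ∈ A, ∃ y ∈ A, x + y = t := by
  classical
  obtain ⟨y, hy⟩ := Finset.inter_nonempty_of_card_lt_card_add_card
    (u := A.image fun x => -x + t) A.subset_univ (Finset.subset_univ _) (by
      have hinj : Function.Injective fun x => -x + t :=
        (add_left_injective t).comp neg_injective
      rwa [Finset.card_image_of_injective _ hinj, ← two_mul])
  obtain ⟨hyA, x, hx, rfl⟩ : y ∈ A ∧ ∃ x ∈ A, -x + t = y := by simpa using hy
  exact ⟨x, hx, _, hyA, add_neg_cancel_left x t⟩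

/-- The residue classes `x` that have a lift `y` whose discriminant `y ^ 2 - 4` is not a square in
the local field. They include `x = -2`, a suitable lift of which has a discriminant of odd
valuation. -/
def IsNonsplitResidue {F : Type*} [Field F] (x : F) : Prop := x = -2 ∨ ¬ IsSquare (x ^ 2 - 4)

variable {F : Type*} [Field F]

/-- The parametrization comes from the traces of the norm-one elements `(r + √d) / (r - √d)` of
the quadratic extension generated by `√d`. -/
theorem isNonsplitResidue_two_add_div [NeZero (2 : F)] {d : F} (hd : ¬ IsSquare d) (r : F) :
    IsNonsplitResidue (2 + 4 * d / (r ^ 2 - d)) := by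
  have hd₀ : d ≠ 0 := fun h => hd (h ▸ IsSquare.zero)
  have hrd : r ^ 2 - d ≠ 0 := fun h => hd ⟨r, by linear_combination -h⟩
  obtain rfl | hr := eq_or_ne r 0
  · left
    rw [zero_pow two_ne_zero, zero_sub, div_neg, mul_div_cancel_right₀ _ hd₀]
    ring
  · right
    rintro ⟨e, he⟩
    have h₄ : (4 : F) ≠ 0 := by
      rw [show (4 : F) = 2 * 2 by norm_num]
      exact mul_ne_zero two_ne_zero two_ne_zero
    refine hd ⟨e * (r ^ 2 - d) / (4 * r), ?_⟩
    field_simp at he ⊢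
    linear_combination he

theorem card_lt_two_mul_card_isNonsplitResidue [Fintype F]
    [DecidablePred (IsNonsplitResidue (F := F))] (hF : ringChar F ≠ 2) :
    Fintype.card F < 2 * (Finset.univ.filter (IsNonsplitResidue (F := F))).card := by
  classical
  have : NeZero (2 : F) := ⟨Ring.two_ne_zero hF⟩
  obtain ⟨d, hd⟩ := FiniteField.exists_nonsquare hF
  have hd₀ : d ≠ 0 := fun h => hd (h ▸ IsSquare.zero)
  have h₄ : 4 * d ≠ 0 := by
    rw [show (4 : F) = 2 * 2 by norm_num]
    exact mul_ne_zero (mul_ne_zero two_ne_zero two_ne_zero) hd₀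
  set squares := Finset.univ.image fun r : F => r ^ 2
  have hcard : Fintype.card F ≤ 2 * squares.card := by
    have := FiniteField.card_image_polynomial_eval (R := F) (p := Polynomial.X ^ 2) (by simp)
    simpa only [Polynomial.natDegree_X_pow, Polynomial.eval_pow, Polynomial.eval_X] using this
  have hmaps : Set.MapsTo (fun z => 2 + 4 * d / (z - d)) squares
      (Finset.univ.filter (IsNonsplitResidue (F := F))) := by
    intro z hz
    obtain ⟨r, rfl⟩ : ∃ r, r ^ 2 = z := by simpa [squares] using hz
    simpa using isNonsplitResidue_two_add_div hd r
  have hinj : Set.InjOn (fun z => 2 + 4 * d / (z - d)) squares := by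
    intro z _ w _ hzw
    have hdiv : (z - d)⁻¹ = (w - d)⁻¹ := by
      simpa only [add_right_inj, div_eq_mul_inv, mul_right_inj' h₄] using hzw
    simpa using hdiv
  have := FiniteField.odd_card_of_char_ne_two hF
  have := Finset.card_le_card_of_injOn _ hmaps hinj
  lia

theorem exists_add_isNonsplitResidue [Finite F] (hF : ringChar F ≠ 2) (t : F) :
    ∃ x y : F, x + y = t ∧ IsNonsplitResidue x ∧ IsNonsplitResidue y := by
  classical
  have := Fintype.ofFinite F
  obtain ⟨x, hx, y, hy, hxy⟩ :=
    exists_add_eq_of_card_lt_two_mul_card (card_lt_two_mul_card_isNonsplitResidue hF) t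
  exact ⟨x, y, hxy, (Finset.mem_filter.1 hx).2, (Finset.mem_filter.1 hy).2⟩

end FiniteFieldTrace

section TraceChoice

/-- Multiplied by any square prime to `p`, the discriminant `y ^ 2 - 4` of the integral trace `y`
is not a square in `ℚ_p`, and this persists under perturbations by multiples of `p ^ 4`. -/
def IsNonsplitTrace (p : Nat.Primes) (y : ℤ) : Prop :=
  ∀ c r : ℤ, ¬ (p : ℤ) ∣ r → c ≡ r ^ 2 * (y ^ 2 - 4) [ZMOD (p : ℤ) ^ 4] →
    IsSymbolNonsquare (.finite p) c

namespace IsNonsplitTrace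

variable {p : Nat.Primes}

theorem of_not_isSquare (hp₂ : (p : ℕ) ≠ 2) {y : ℤ} (h : ¬ IsSquare ((y : ZMod p) ^ 2 - 4)) :
    IsNonsplitTrace p y := by
  intro c r hr hc
  have hr' : Int.gcd r p = 1 :=
    Int.isCoprime_iff_gcd_eq_one.1 (((Nat.prime_iff_prime_int.1 p.2).coprime_iff_not_dvd.2 hr).symm)
  refine IsSymbolNonsquare.of_jacobiSym hp₂ ?_
  rw [jacobiSym.mod_left' (hc.of_dvd (dvd_pow_self _ four_ne_zero)), jacobiSym.mul_left,
    jacobiSym.sq_one' hr', one_mul, ZMod.nonsquare_iff_jacobiSym_eq_neg_one]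
  exact_mod_cast h

theorem neg_two_add (hp₂ : (p : ℕ) ≠ 2) {u : ℤ} (hu : ¬ (p : ℤ) ∣ u) :
    IsNonsplitTrace p (-2 + p * u) := by
  intro c r hr hc
  obtain ⟨k, hk⟩ := hc.symm.dvd
  obtain rfl : c = p * (-(r * r * u * 4) + p * (r ^ 2 * u ^ 2 + p ^ 2 * k)) := by
    linear_combination hk
  refine IsSymbolNonsquare.prime_mul hp₂ ?_
  rw [Int.dvd_add_left (dvd_mul_right _ _), dvd_neg]
  exact not_dvd_mul (not_dvd_mul (not_dvd_mul hr hr) hu) (not_dvd_four hp₂)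

theorem two_of_odd {y : ℤ} (hy : Odd y) : IsNonsplitTrace primeTwo y := by
  intro c r hr hc
  obtain ⟨z, rfl⟩ := hy
  obtain ⟨w, rfl⟩ : Odd r := Int.not_even_iff_odd.1 fun h => hr h.two_dvd
  have hmod : ∀ W Z : ZMod 8, (2 * W + 1) ^ 2 * ((2 * Z + 1) ^ 2 - 4) = 5 := by decide
  refine IsSymbolNonsquare.of_mod_eight ((hc.of_dvd (by decide)).trans ?_)
  exact (ZMod.intCast_eq_intCast_iff _ _ 8).1 (by exact_mod_cast hmod w z)

theorem two_zero : IsNonsplitTrace primeTwo 0 := by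
  intro c r hr hc
  obtain ⟨w, rfl⟩ : Odd r := Int.not_even_iff_odd.1 fun h => hr h.two_dvd
  have hmod : ∀ W : ZMod 16, (2 * W + 1) ^ 2 * (0 ^ 2 - 4) = 12 := by decide
  refine IsSymbolNonsquare.of_mod_sixteen ((hc.of_dvd (by decide)).trans ?_)
  exact (ZMod.intCast_eq_intCast_iff _ _ 16).1 (by exact_mod_cast hmod w)

theorem exists_intCast_eq (hp₂ : (p : ℕ) ≠ 2) {x : ZMod p} (hx : IsNonsplitResidue x) :
    ∃ y : ℤ, (y : ZMod p) = x ∧ IsNonsplitTrace p y := by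
  rcases hx with rfl | hx
  · exact ⟨-2 + p * 1, by simp, neg_two_add hp₂ not_dvd_one⟩
  · obtain ⟨y, rfl⟩ := ZMod.intCast_surjective x
    exact ⟨y, rfl, of_not_isSquare hp₂ hx⟩

theorem exists_add_of_not_isSquare (hp₂ : (p : ℕ) ≠ 2) {t : ℤ} {x y : ZMod p} (hxy : x + y = t)
    (hx : ¬ IsSquare (x ^ 2 - 4)) (hy : IsNonsplitResidue y) :
    ∃ s s' : ℤ, s + s' = t ∧ IsNonsplitTrace p s ∧ IsNonsplitTrace p s' := by
  obtain ⟨s', rfl, hs'⟩ := exists_intCast_eq hp₂ hy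
  refine ⟨t - s', s', sub_add_cancel t s', of_not_isSquare hp₂ ?_, hs'⟩
  rwa [Int.cast_sub, ← hxy, add_sub_cancel_right]

theorem exists_add_of_neg_two (hp₂ : (p : ℕ) ≠ 2) {t : ℤ} (ht : (-2 + -2 : ZMod p) = t) :
    ∃ s s' : ℤ, s + s' = t ∧ IsNonsplitTrace p s ∧ IsNonsplitTrace p s' := by
  obtain ⟨u, hu⟩ := (ZMod.intCast_zmod_eq_zero_iff_dvd (t + 4) p).1
    (by push_cast; linear_combination -ht)
  obtain ⟨v, hv, huv⟩ : ∃ v : ℤ, ¬ (p : ℤ) ∣ v ∧ ¬ (p : ℤ) ∣ u - v := by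
    by_cases h : (p : ℤ) ∣ u - 1
    · refine ⟨-1, not_dvd_neg_one, fun h' => not_dvd_four (p := p) hp₂ ?_⟩
      have := (dvd_sub h' h).mul_left 2
      rwa [show 2 * (u - -1 - (u - 1)) = 4 by ring] at this
    · exact ⟨1, not_dvd_one, h⟩
  exact ⟨-2 + p * v, -2 + p * (u - v), by linear_combination -hu, neg_two_add hp₂ hv,
    neg_two_add hp₂ huv⟩

theorem exists_add (p : Nat.Primes) (t : ℤ) :
    ∃ s s' : ℤ, s + s' = t ∧ IsNonsplitTrace p s ∧ IsNonsplitTrace p s' := by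
  by_cases hp₂ : (p : ℕ) = 2
  · obtain rfl : p = primeTwo := Subtype.ext hp₂
    rcases Int.even_or_odd t with h | h
    · exact ⟨1, t - 1, add_sub_cancel 1 t, two_of_odd odd_one, two_of_odd (h.sub_odd odd_one)⟩
    · exact ⟨0, t, zero_add t, two_zero, two_of_odd h⟩
  obtain ⟨x, y, hxy, hx, hy⟩ := exists_add_isNonsplitResidue (F := ZMod p)
    (by rwa [ZMod.ringChar_zmod_n]) t
  rcases hx with rfl | hx'
  · rcases hy with rfl | hy'
    · exact exists_add_of_neg_two hp₂ hxy
    · exact exists_add_of_not_isSquare hp₂ (by rw [add_comm, hxy]) hy' (.inl rfl)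
  · exact exists_add_of_not_isSquare hp₂ hxy hx' hy

end IsNonsplitTrace

/-- The second discriminant is that of the complementary trace `t₁ / t₂ - s`, cleared of
denominators. -/
theorem exists_local_trace (p : Nat.Primes) (t₁ : ℤ) {t₂ : ℤ} (ht₂ : ¬ (p : ℤ) ∣ t₂) :
    ∃ s : ℤ, IsSymbolNonsquare (.finite p) (s ^ 2 - 4) ∧
      IsSymbolNonsquare (.finite p) ((t₁ - s * t₂) ^ 2 - 4 * t₂ ^ 2) := by
  obtain ⟨u, v, huv⟩ : IsCoprime t₂ ((p : ℤ) ^ 4) :=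
    (((Nat.prime_iff_prime_int.1 p.2).coprime_iff_not_dvd.2 ht₂).symm).pow_right
  obtain ⟨s, s', hss', hs, hs'⟩ := IsNonsplitTrace.exists_add p (t₁ * u)
  have hmod : t₁ - s * t₂ ≡ s' * t₂ [ZMOD (p : ℤ) ^ 4] :=
    (Int.modEq_iff_dvd.2 ⟨t₁ * v, by linear_combination (-t₁) * huv - t₂ * hss'⟩).symm
  refine ⟨s, hs _ 1 not_dvd_one (by rw [one_pow, one_mul]), hs' _ t₂ ht₂ ?_⟩
  rw [show t₂ ^ 2 * (s' ^ 2 - 4) = (s' * t₂) ^ 2 - 4 * t₂ ^ 2 by ring]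
  exact (hmod.pow 2).sub_right _

theorem exists_modEq_abs_div_sub_lt {K : Type*} [Field K] [LinearOrder K] [IsStrictOrderedRing K]
    [Archimedean K] {M : ℕ} (hM : M ≠ 0) (s : ℤ) (x : K) {δ : K} (hδ : 0 < δ) :
    ∃ S N : ℤ, 0 < N ∧ S ≡ s [ZMOD M] ∧ N ≡ 1 [ZMOD M] ∧ |S / N - x| < δ := by
  have hM' : (0 : K) < M := by exact_mod_cast Nat.pos_of_ne_zero hM
  obtain ⟨L, hL⟩ := exists_nat_gt (1 / δ)
  rw [div_lt_iff₀ hδ] at hL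
  set N : ℤ := M * L + 1
  have hN : (N : K) = M * L + 1 := by simp [N]
  have hN₀ : (0 : K) < N := by rw [hN]; positivity
  obtain ⟨k, hk, -⟩ := existsUnique_sub_zsmul_mem_Ico hM' (N * x - s) 0
  rw [zsmul_eq_mul, Set.mem_Ico, zero_add] at hk
  refine ⟨s + M * k, N, by exact_mod_cast hN₀, by simp, by simp [N], ?_⟩
  have hsmall : |N * x - s - k * M| < δ * N := by
    rw [abs_of_nonneg hk.1]
    refine hk.2.trans ?_
    rw [hN]
    nlinarith
  rw [abs_sub_comm, ← mul_lt_mul_iff_left₀ hN₀, ← abs_of_pos hN₀, ← abs_mul, abs_of_pos hN₀]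
  convert hsmall using 2
  push_cast
  field_simp
  ring

theorem exists_global_trace (P : Finset Nat.Primes) (t₁ : ℤ) {t₂ : ℤ}
    (ht₂ : ∀ p ∈ P, ¬ (p : ℤ) ∣ t₂) {K : Type*} [Field K] [LinearOrder K] [IsStrictOrderedRing K]
    [Archimedean K] (x : K) {δ : K} (hδ : 0 < δ) :
    ∃ S N : ℤ, 0 < N ∧ |S / N - x| < δ ∧ ∀ p ∈ P,
      IsSymbolNonsquare (.finite p) (S ^ 2 - 4 * N ^ 2) ∧
        IsSymbolNonsquare (.finite p) ((t₁ * N - S * t₂) ^ 2 - 4 * (t₂ * N) ^ 2) := by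
  choose! s hs using fun p hp => exists_local_trace p t₁ (ht₂ p hp)
  set e : Nat.Primes → ℕ := fun p => max (padicValInt p (s p ^ 2 - 4))
    (padicValInt p ((t₁ - s p * t₂) ^ 2 - 4 * t₂ ^ 2)) + 3
  obtain ⟨s₀, hs₀⟩ := exists_forall_modEq P e s
  obtain ⟨S, N, hN₀, hS, hN, hx⟩ := exists_modEq_abs_div_sub_lt
    (M := ∏ p ∈ P, (p : ℕ) ^ e p)
    (Finset.prod_ne_zero_iff.2 fun p _ => pow_ne_zero _ p.2.ne_zero) s₀ x hδ
  refine ⟨S, N, hN₀, hx, fun p hp => ?_⟩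
  have hpM : (p : ℤ) ^ e p ∣ (∏ p ∈ P, (p : ℕ) ^ e p : ℕ) := by
    exact_mod_cast Finset.dvd_prod_of_mem _ hp
  have hSp : S ≡ s p [ZMOD (p : ℤ) ^ e p] := (hS.of_dvd hpM).trans (hs₀ p hp)
  have hNp : N ≡ 1 [ZMOD (p : ℤ) ^ e p] := hN.of_dvd hpM
  have hval₁ : padicValInt p (s p ^ 2 - 4) + 3 ≤ e p := Nat.add_le_add_right (le_max_left ..) 3
  have hval₂ : padicValInt p ((t₁ - s p * t₂) ^ 2 - 4 * t₂ ^ 2) + 3 ≤ e p :=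
    Nat.add_le_add_right (le_max_right ..) 3
  constructor
  · refine (hs p hp).1.congr (.of_dvd (pow_dvd_pow _ hval₁) ?_)
    simpa using (hSp.pow 2).sub ((hNp.pow 2).mul_left 4)
  · refine (hs p hp).2.congr (.of_dvd (pow_dvd_pow _ hval₂) ?_)
    simpa using (((hNp.mul_left t₁).sub (hSp.mul_right t₂)).pow 2).sub
      (((hNp.mul_left t₂).pow 2).mul_left 4)

end TraceChoice

section NormOneTraces

variable {a b : ℚ}

theorem num_mul_den_eq (a : ℚ) : ((a.num * a.den : ℤ) : ℚ) = a * (a.den : ℚ) ^ 2 := by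
  push_cast
  rw [sq, ← mul_assoc, Rat.mul_den_eq_num]

theorem num_mul_den_ne_zero (ha : a ≠ 0) : a.num * a.den ≠ 0 :=
  mul_ne_zero (Rat.num_ne_zero.2 ha) (Int.natCast_ne_zero.2 a.den_ne_zero)

theorem splitsOver_mul_sq_iff {r s : ℚ} (K : Type) [Field K] [Algebra ℚ K] (ha : a ≠ 0)
    (hb : b ≠ 0) (hr : r ≠ 0) (hs : s ≠ 0) :
    SplitsOver (a * r ^ 2) (b * s ^ 2) K ↔ SplitsOver a b K := by
  have : CharZero K := algebraRat.charZero K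
  have hr' : (r : K) ≠ 0 := Rat.cast_ne_zero.2 hr
  have hs' : (s : K) ≠ 0 := Rat.cast_ne_zero.2 hs
  rw [splitsOver_iff_isNormFrom K ha hb, splitsOver_iff_isNormFrom K
    (mul_ne_zero ha (pow_ne_zero 2 hr)) (mul_ne_zero hb (pow_ne_zero 2 hs))]
  push_cast
  rw [IsNormFrom.mul_sq_right_iff hs', IsNormFrom.mul_sq_left_iff hr']

theorem splitsAt_mul_sq_iff {r s : ℚ} (ha : a ≠ 0) (hb : b ≠ 0) (hr : r ≠ 0) (hs : s ≠ 0) :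
    ∀ v, SplitsAt (a * r ^ 2) (b * s ^ 2) v ↔ SplitsAt a b v
  | .infinite => splitsOver_mul_sq_iff ℝ ha hb hr hs
  | .finite p => splitsOver_mul_sq_iff ℚ_[p] ha hb hr hs

theorem splitsAt_iff_hilbertSymbol_num_mul_den (ha : a ≠ 0) (hb : b ≠ 0) (v : RatPlace) :
    SplitsAt a b v ↔ hilbertSymbol v (a.num * a.den) (b.num * b.den) = 1 := by
  rw [← splitsAt_iff_hilbertSymbol_eq_one (num_mul_den_ne_zero ha) (num_mul_den_ne_zero hb),
    num_mul_den_eq, num_mul_den_eq]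
  exact (splitsAt_mul_sq_iff ha hb (Nat.cast_ne_zero.2 a.den_ne_zero)
    (Nat.cast_ne_zero.2 b.den_ne_zero) v).symm

theorem finite_ramifiedPlaces (ha : a ≠ 0) (hb : b ≠ 0) : (ramifiedPlaces a b).Finite :=
  (finite_mulSupport_hilbertSymbol (num_mul_den_ne_zero ha) (num_mul_den_ne_zero hb)).subset
    fun v hv h => hv ((splitsAt_iff_hilbertSymbol_num_mul_den ha hb v).2 h)

theorem splitsOver_of_mem_traceSet {s : ℚ} (K : Type) [Field K] [Algebra ℚ K] (ha : a ≠ 0)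
    (hb : b ≠ 0) (hs : s ∈ traceSet a b) (h4 : s ^ 2 ≠ 4) (h : IsSquare ((s : K) ^ 2 - 4)) :
    SplitsOver a b K := by
  have : CharZero K := algebraRat.charZero K
  obtain ⟨x₁, x₂, x₃, x₄, hx, rfl⟩ := hs
  obtain ⟨d, hd⟩ := h
  have hxK := congrArg (Rat.cast : ℚ → K) hx
  push_cast at hxK hd
  have hd₀ : d ≠ 0 := by
    rintro rfl
    refine h4 (Rat.cast_injective (α := K) ?_)
    push_cast
    linear_combination hd
  -- The pure part of the norm-one element squares to `(d / 2) ^ 2`.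
  exact (splitsOver_iff_isNormFrom K ha hb).2 <|
    .of_isotropic_normForm (x := d / 2) (y := x₂) (z := x₃) (w := x₄) (Rat.cast_ne_zero.2 ha)
      (by linear_combination hxK - hd / 4) (Or.inl (div_ne_zero hd₀ two_ne_zero))

theorem norm_le_one_of_mem_traceSet {p : ℕ} [Fact p.Prime] {s : ℚ} (ha : a ≠ 0) (hb : b ≠ 0)
    (hns : ¬ SplitsOver a b ℚ_[p]) (hs : s ∈ traceSet a b) : ‖(s : ℚ_[p])‖ ≤ 1 := by
  by_contra! h
  have hs₀ : (s : ℚ_[p]) ≠ 0 := norm_pos_iff.1 (one_pos.trans h)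
  have hsq : 1 < ‖(s : ℚ_[p]) ^ 2‖ := by
    rw [norm_pow]
    exact one_lt_pow₀ h two_ne_zero
  refine hns (splitsOver_of_mem_traceSet ℚ_[p] ha hb hs ?_ ?_)
  · intro h4
    have h4' : (s : ℚ_[p]) ^ 2 = (4 : ℤ) := by exact_mod_cast congrArg (Rat.cast : ℚ → ℚ_[p]) h4
    exact hsq.not_ge (h4' ▸ Padic.norm_int_le_one 4)
  · have hw : ‖-((s : ℚ_[p]) ^ 2)⁻¹‖ < 1 := by
      rw [norm_neg, norm_inv]
      exact inv_lt_one_of_one_lt₀ hsq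
    have heq : (s : ℚ_[p]) ^ 2 - 4 = s ^ 2 * (1 + 4 * -((s : ℚ_[p]) ^ 2)⁻¹) := by
      field_simp
      ring
    rw [heq]
    exact (IsSquare.sq _).mul (isSquare_one_add_four_mul hw)

theorem abs_le_two_of_mem_traceSet {s : ℚ} (ha : a ≠ 0) (hb : b ≠ 0)
    (hns : ¬ SplitsOver a b ℝ) (hs : s ∈ traceSet a b) : |s| ≤ 2 := by
  by_contra! h
  have h4 : 4 < s ^ 2 := by
    rw [← sq_abs]
    nlinarith
  have h4' : (4 : ℝ) < (s : ℝ) ^ 2 := by exact_mod_cast h4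
  exact hns (splitsOver_of_mem_traceSet ℝ ha hb hs h4.ne' (Real.isSquare_iff.2 (by linarith)))

theorem not_dvd_den_of_norm_le_one {p : ℕ} [Fact p.Prime] {q : ℚ} (h : ‖(q : ℚ_[p])‖ ≤ 1) :
    ¬ p ∣ q.den := fun hp =>
  PadicInt.not_isUnit_iff.2 (PadicInt.norm_natCast_lt_one_iff.2 hp) (PadicInt.isUnit_den q h)

theorem traceSumSet_subset (ha : a ≠ 0) (hb : b ≠ 0) :
    traceSumSet a b ⊆ ⋂ v ∈ ramifiedPlaces a b, localIntegers v := by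
  rintro _ ⟨s, hs, s', hs', rfl⟩
  refine Set.mem_iInter₂.2 fun v hv => ?_
  cases v with
  | infinite =>
    have h := abs_le.1 (abs_le_two_of_mem_traceSet ha hb hv hs)
    have h' := abs_le.1 (abs_le_two_of_mem_traceSet ha hb hv hs')
    exact ⟨by linarith, by linarith⟩
  | finite p =>
    refine not_dvd_den_of_norm_le_one ?_
    push_cast
    exact (Padic.nonarchimedean _ _).trans
      (max_le (norm_le_one_of_mem_traceSet ha hb hv hs) (norm_le_one_of_mem_traceSet ha hb hv hs'))

theorem mem_traceSet_of_forall_isSymbolNonsquare (ha : a ≠ 0) (hb : b ≠ 0) {s : ℚ} {c N : ℤ}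
    (hN : N ≠ 0) (hc : (c : ℚ) = (s ^ 2 - 4) * N ^ 2)
    (h : ∀ v ∈ ramifiedPlaces a b, IsSymbolNonsquare v c) : s ∈ traceSet a b := by
  have hN' : (N : ℚ) ≠ 0 := Int.cast_ne_zero.2 hN
  by_cases hc₀ : c = 0
  · have hs : s ^ 2 - 4 = 0 := by simpa [hc₀, hN'] using hc.symm
    exact ⟨s / 2, 0, 0, 0, by linear_combination hs / 4, by ring⟩
  obtain ⟨x, y, z, hxyz⟩ := exists_pure_sq_eq_of_hilbertSymbol (num_mul_den_ne_zero ha)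
    (num_mul_den_ne_zero hb) hc₀ fun v =>
      (em (SplitsAt a b v)).imp (splitsAt_iff_hilbertSymbol_num_mul_den ha hb v).1 fun hv =>
        (h v hv).2
  rw [num_mul_den_eq, num_mul_den_eq, hc] at hxyz
  refine ⟨s / 2, a.den * x / (2 * N), b.den * y / (2 * N), a.den * b.den * z / (2 * N), ?_,
    by ring⟩
  field_simp
  linear_combination -hxyz

theorem isSymbolNonsquare_infinite_of_abs_lt_two {u : ℚ} {c N : ℤ} (hN : N ≠ 0) (hu : |u| < 2)
    (hc : (c : ℚ) = (u ^ 2 - 4) * N ^ 2) : IsSymbolNonsquare .infinite c := by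
  have hu4 : u ^ 2 < 4 := by
    rw [← sq_abs]
    nlinarith [abs_nonneg u]
  have hN2 : (0 : ℚ) < (N : ℚ) ^ 2 := sq_pos_of_ne_zero (Int.cast_ne_zero.2 hN)
  have hc' : (c : ℚ) < 0 := hc ▸ mul_neg_of_neg_of_pos (by linarith) hN2
  exact .infinite_of_neg (by exact_mod_cast hc')

theorem exists_abs_lt_two_of_near_half {K : Type*} [Field K] [LinearOrder K]
    [IsStrictOrderedRing K] {t : K} (ht : |t| ≠ 4) :
    ∃ δ > 0, ∀ s, |s - t / 2| < δ → |t| ≤ 4 → |s| < 2 ∧ |t - s| < 2 := by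
  rcases ht.lt_or_gt with h | h
  · refine ⟨2 - |t| / 2, by linarith, fun s hs _ => ?_⟩
    have hs' := abs_lt.1 hs
    have h₁ := le_abs_self t
    have h₂ := neg_abs_le t
    constructor <;> rw [abs_lt] <;> constructor <;> linarith
  · exact ⟨1, one_pos, fun s _ h' => absurd h' h.not_ge⟩

theorem mem_traceSumSet_of_abs_eq_four {t : ℚ} (ht : |t| = 4) : t ∈ traceSumSet a b := by
  have hmem : t / 2 ∈ traceSet a b := by
    refine ⟨t / 4, 0, 0, 0, ?_, by ring⟩
    have := sq_abs t
    rw [ht] at this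
    linear_combination -this / 16
  exact ⟨t / 2, hmem, t / 2, hmem, add_halves t⟩

theorem subset_traceSumSet (ha : a ≠ 0) (hb : b ≠ 0) :
    ⋂ v ∈ ramifiedPlaces a b, localIntegers v ⊆ traceSumSet a b := by
  intro t ht
  have ht := Set.mem_iInter₂.1 ht
  by_cases h4 : |t| = 4
  · exact mem_traceSumSet_of_abs_eq_four h4
  have hfin : (RatPlace.finite ⁻¹' ramifiedPlaces a b).Finite :=
    (finite_ramifiedPlaces ha hb).preimage fun _ _ _ _ h => RatPlace.finite.inj h
  obtain ⟨δ, hδ, hinf⟩ := exists_abs_lt_two_of_near_half h4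
  obtain ⟨S, N, hN, hSN, hSym⟩ := exists_global_trace hfin.toFinset t.num (t₂ := t.den)
    (fun p hp => by exact_mod_cast ht _ (hfin.mem_toFinset.1 hp)) (t / 2) hδ
  have hdN : (t.den * N : ℤ) ≠ 0 := mul_ne_zero (Int.natCast_ne_zero.2 t.den_ne_zero) hN.ne'
  have hNQ : (N : ℚ) ≠ 0 := Int.cast_ne_zero.2 hN.ne'
  have hc : ((S ^ 2 - 4 * N ^ 2 : ℤ) : ℚ) = ((S / N) ^ 2 - 4) * (N : ℚ) ^ 2 := by
    push_cast
    field_simp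
  have hc' : (((t.num * N - S * t.den) ^ 2 - 4 * (t.den * N) ^ 2 : ℤ) : ℚ) =
      ((t - S / N) ^ 2 - 4) * ((t.den * N : ℤ) : ℚ) ^ 2 := by
    push_cast
    rw [← Rat.mul_den_eq_num t]
    field_simp
  refine ⟨S / N, mem_traceSet_of_forall_isSymbolNonsquare ha hb hN.ne' hc fun v hv => ?_,
    t - S / N, mem_traceSet_of_forall_isSymbolNonsquare ha hb hdN hc' fun v hv => ?_,
    add_sub_cancel _ _⟩
  · cases v with
    | infinite =>
      exact isSymbolNonsquare_infinite_of_abs_lt_two hN.ne' (hinf _ hSN (abs_le.2 (ht _ hv))).1 hc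
    | finite p => exact (hSym p (hfin.mem_toFinset.2 hv)).1
  · cases v with
    | infinite =>
      exact isSymbolNonsquare_infinite_of_abs_lt_two hdN (hinf _ hSN (abs_le.2 (ht _ hv))).2 hc'
    | finite p => exact (hSym p (hfin.mem_toFinset.2 hv)).2

end NormOneTraces

theorem mainTheorem7 (a b : ℚ) (ha : a ≠ 0) (hb : b ≠ 0) :
    (traceSumSet a b = ⋂ v ∈ ramifiedPlaces a b, localIntegers v) ∧
      (ramifiedPlaces a b = ∅ → traceSumSet a b = Set.univ) := by
  have h := (traceSumSet_subset ha hb).antisymm (subset_traceSumSet ha hb)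
  refine ⟨h, fun hempty => ?_⟩
  rw [h, hempty, Set.biInter_empty]
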